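/- Let $g\colon[0,1]\to[0,\infty)$ be piecewise $C^2$: there is a partition $0=p_0<p_1<\dots<p_n=1$ such that $g$ is $C^2$ on each $(p_{i},p_{i+1})$, and $g,g',g''$ have finite one-sided limits at the endpoints of each of these intervals (in particular $g$ is bounded). Suppose that for some $\varepsilon>0$ we have $g(x)\ge\varepsilon$ for all $x\in[0,1]$ with $x\ge 1-\varepsilon$. Let $T$ be a random variable with $$\mathbb E\,e^{\theta T}=\exp\Big(\int_0^1(e^{\theta x}-1)\,g(x)\,dx\Big)\qquad\text{for all }\theta\in\mathbb R .$$ For $\beta\in\mathbb R$ let $T_\beta$ be distributed as the Cramér $\beta$-tilt of $T$, that is, $\mathbb P(T_\beta\in dt)=e^{\beta t}\,\mathbb P(T\in dt)/\mathbb E\,e^{\beta T}$. Let $E_\beta$ and $\sigma_\beta^2$ be the mean and the variance of $T_\beta$, with $\sigma_\beta\geq 0$, and let $Y=Y_\beta=(T_\beta-E_\beta)/\sigma_\beta$. Then $E_\beta\to\infty$ as $\beta\to\infty$. Moreover, for every $\beta$, $Y_\beta$ has an atom at $-E_\beta/\sigma_\beta$ and apart from that atom a (defective) density $f_Y=f_{Y_\beta}$,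 which can be chosen continuous off a finite set and at every $y$ with $E_\beta+\sigma_\beta y>1$ (so $f_Y$ is determined up to its values at finitely many points, and $f_Y(0)$ is determined once $E_\beta>1$), such that, as $\beta\to\infty$, $$f_Y(y)=\frac{1}{\sqrt{2\pi}}\,e^{-y^2/2}+O\Big(\frac1{\sqrt{E_\beta}}\Big)\quad\text{uniformly in } y\in\mathbb R, \qquad f_Y(0)=\frac1{\sqrt{2\pi}}+O\Big(\frac1{E_\beta}\Big).$$ -/

import Mathlib

open MeasureTheory ProbabilityTheory Filter Topology Set

noncomputable section

/-- `g` is piecewise `C^k` on `[a, b]`: there are points `a = p 0 < p 1 < ⋯ < p n = b` such that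
`g` is `C^k` on each open interval `(p i, p (i+1))`, and `g` and its first `k` derivatives have
finite one-sided limits at both endpoints of each of these intervals. The values of `g` at the
points `p i` themselves are arbitrary. -/
def PiecewiseC (k : ℕ) (g : ℝ → ℝ) (a b : ℝ) : Prop :=
  ∃ (n : ℕ) (p : Fin (n + 1) → ℝ), StrictMono p ∧ p 0 = a ∧ p (Fin.last n) = b ∧
    ∀ i : Fin n,
      ContDiffOn ℝ k g (Ioo (p i.castSucc) (p i.succ)) ∧
      ∀ j : ℕ, j ≤ k →
        (∃ l : ℝ, Tendsto (iteratedDeriv j g) (𝓝[>] (p i.castSucc)) (𝓝 l)) ∧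
        (∃ l : ℝ, Tendsto (iteratedDeriv j g) (𝓝[<] (p i.succ)) (𝓝 l))

/-- The random variable `T` has the infinitely divisible law with Lévy measure `g(x) dx` on
`[0, 1]`: `E exp(θ T) = exp (∫₀¹ (exp(θ x) - 1) g(x) dx)` for all real `θ`. (The right side is
positive, so this includes the finiteness of the left side.) -/
def HasLevyDensity {Ω : Type*} [MeasurableSpace Ω] (P : Measure Ω) (T : Ω → ℝ) (g : ℝ → ℝ) :
    Prop :=
  AEMeasurable T P ∧
    ∀ θ : ℝ, mgf T P θ = Real.exp (∫ x in (0 : ℝ)..1, (Real.exp (θ * x) - 1) * g x)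

/-- The Cramér `β`-tilt of a law `ν` on the line: `exp(β t) ν(dt) / ∫ exp(β s) ν(ds)`. -/
def cramerTilt (ν : Measure ℝ) (β : ℝ) : Measure ℝ :=
  ν.tilted (fun t => β * t)

/-- The mean `E_β` of the `β`-tilt of `ν`. -/
def tiltMean (ν : Measure ℝ) (β : ℝ) : ℝ :=
  ∫ t, t ∂(cramerTilt ν β)

/-- The standard deviation `σ_β` of the `β`-tilt of `ν`. -/
def tiltSD (ν : Measure ℝ) (β : ℝ) : ℝ :=
  Real.sqrt (variance (fun t : ℝ => t) (cramerTilt ν β))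

/-- The law of `Y_β = (T_β - E_β) / σ_β`, where `T_β` is distributed as the `β`-tilt of `ν`. -/
def standardizedTilt (ν : Measure ℝ) (β : ℝ) : Measure ℝ :=
  (cramerTilt ν β).map (fun t => (t - tiltMean ν β) / tiltSD ν β)

/-- `f` is a defective density of the law `ν`, whose only atom is the point `a`:
`ν = ν{a} δ_a + f(y) dy` with `ν{a} > 0`. -/
def IsDefectiveDensity (ν : Measure ℝ) (a : ℝ) (f : ℝ → ℝ) : Prop :=
  Measurable f ∧ (∀ y, 0 ≤ f y) ∧ 0 < ν {a} ∧
    ν = ν {a} • Measure.dirac a + volume.withDensity (fun y => ENNReal.ofReal (f y))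

end

/-!
By analyticity of the moment generating function, `T_β` is compound Poisson with jump measure
`μ = exp (β x) g(x) dx`, so its mean and variance are the first two moments `E` and `σ²` of `μ`,
which are comparable because `g` is bounded, and bounded below near `1`. The parts of the law with
no jump and with one jump are explicit and exponentially small. The part with at least two jumps has
characteristic function `exp (-λ) (exp (μ̂ t) - 1 - μ̂ t)`, where `λ` is the mass of `μ`. It is
integrable, since `μ̂` is square integrable by Plancherel, so its density is given by Fourier
inversion and can be compared with that of the Gaussian:

* for `|t| ≤ π`, a Taylor expansion of `μ̂` gives an error `O(1 / σ)` after rescaling, and at the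
  mean the cubic term integrates to zero by oddness, which improves this to `O(1 / σ²)`;
* for `|t| ≥ π`, the lower bound of `g` near `1` keeps `Re μ̂ t` so far below `λ` that the integral
  is exponentially small in `β`.
-/

open Complex (I)
open scoped Real NNReal ENNReal FourierTransform

section FourierInversion

variable {μ : Measure ℝ}

/-- The inverse Fourier transform of the characteristic function of `μ`. If that characteristic
function is integrable, this is the continuous version of the density of `μ`. -/
noncomputable def charFunDensity (μ : Measure ℝ) (x : ℝ) : ℝ :=
  (2 * π)⁻¹ * (∫ t : ℝ, Complex.exp (-(t * x * I)) * charFun μ t).re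

lemma norm_cexp_neg_mul_mul_I (t x : ℝ) : ‖Complex.exp (-(t * x * I))‖ = 1 := by
  simpa using Complex.norm_exp_ofReal_mul_I (-(t * x))

lemma integrable_cexp_neg_mul {f : ℝ → ℂ} (hf : Integrable f) (x : ℝ) :
    Integrable fun t : ℝ => Complex.exp (-(t * x * I)) * f t :=
  hf.bdd_mul (c := 1) (by fun_prop) (ae_of_all _ fun t => (norm_cexp_neg_mul_mul_I t x).le)

lemma continuous_charFunDensity (h : Integrable (charFun μ)) : Continuous (charFunDensity μ) := by
  refine continuous_const.mul (Complex.continuous_re.comp ?_)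
  refine continuous_of_dominated (fun x => (integrable_cexp_neg_mul h x).aestronglyMeasurable)
    (fun x => ae_of_all _ fun t => ?_) h.norm (ae_of_all _ fun t => by fun_prop)
  rw [norm_mul, norm_cexp_neg_mul_mul_I, one_mul]

lemma integral_cexp_neg_mul_sq_div_two {v : ℝ≥0} (hv : v ≠ 0) (x y : ℝ) :
    ∫ t : ℝ, Complex.exp (-(t * x * I)) * (Real.exp (-(v * t ^ 2 / 2)) * Complex.exp (t * y * I))
      = ((2 * π * gaussianPDFReal x v y : ℝ) : ℂ) := by
  have hv' : (0 : ℝ) < v := by positivity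
  have hvC : (v : ℂ) ≠ 0 := mod_cast hv
  calc _ = ∫ t : ℝ, Complex.exp (I * (y - x : ℂ) * t) * Complex.exp (-(v / 2 : ℂ) * t ^ 2) := by
        refine integral_congr_ae (ae_of_all _ fun t => ?_)
        simp only [Complex.ofReal_exp, ← Complex.exp_add]
        push_cast
        ring_nf
    _ = (π / (v / 2 : ℂ)) ^ (1 / 2 : ℂ) * Complex.exp (-(y - x : ℂ) ^ 2 / (4 * (v / 2))) :=
        fourierIntegral_gaussian (by simpa using hv') _
    _ = ((√(2 * π / v) * Real.exp (-(y - x) ^ 2 / (2 * v)) : ℝ) : ℂ) := by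
        rw [Real.sqrt_eq_rpow, Complex.ofReal_mul, Complex.ofReal_cpow (by positivity)]
        push_cast
        congr 2 <;> field_simp
        norm_num
    _ = _ := by
        have : √(2 * π / v) = 2 * π * (√(2 * π * v))⁻¹ := by
          rw [Real.sqrt_div' _ hv'.le, Real.sqrt_mul' _ hv'.le, mul_inv, ← mul_assoc,
            ← div_eq_mul_inv (2 * π), Real.div_sqrt, div_eq_mul_inv]
        rw [gaussianPDFReal, ← mul_assoc, this]

theorem integral_exp_neg_mul_charFun (μ : Measure ℝ) [IsFiniteMeasure μ] {v : ℝ≥0} (hv : v ≠ 0)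
    (x : ℝ) :
    ∫ t : ℝ, Complex.exp (-(t * x * I)) * (Real.exp (-(v * t ^ 2 / 2)) * charFun μ t)
      = ((2 * π * ∫ y, gaussianPDFReal x v y ∂μ : ℝ) : ℂ) := by
  have hgauss : Integrable fun t : ℝ => Real.exp (-(v * t ^ 2 / 2)) := by
    simpa [neg_mul, div_mul_eq_mul_div] using
      integrable_exp_neg_mul_sq (b := (v / 2 : ℝ)) (by positivity)
  have hprod : Integrable (Function.uncurry fun t y : ℝ =>
      Complex.exp (-(t * x * I)) * (Real.exp (-(v * t ^ 2 / 2)) * Complex.exp (t * y * I)))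
      (volume.prod μ) := by
    refine (hgauss.mul_prod (integrable_const (1 : ℝ))).mono' (by fun_prop)
      (ae_of_all _ fun p => le_of_eq ?_)
    have h2 := Complex.norm_exp_ofReal_mul_I (p.1 * p.2)
    rw [Complex.ofReal_mul] at h2
    rw [Function.uncurry, norm_mul, norm_mul, norm_cexp_neg_mul_mul_I, h2, Complex.norm_real,
      Real.norm_of_nonneg (by positivity)]
    ring
  simp_rw [charFun_apply_real, ← integral_const_mul]
  rw [integral_integral_swap hprod, ← integral_complex_ofReal]
  exact integral_congr_ae (ae_of_all _ fun y => integral_cexp_neg_mul_sq_div_two hv x y)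

lemma charFun_gaussianReal_eq_mul (m : ℝ) (v : ℝ≥0) (t : ℝ) :
    charFun (gaussianReal m v) t = Real.exp (-(v * t ^ 2 / 2)) * Complex.exp (t * m * I) := by
  rw [charFun_gaussianReal, Complex.ofReal_exp, ← Complex.exp_add]
  push_cast
  ring_nf

theorem charFunDensity_gaussianReal (m : ℝ) {v : ℝ≥0} (hv : v ≠ 0) :
    charFunDensity (gaussianReal m v) = gaussianPDFReal m v := by
  funext x
  simp_rw [charFunDensity, charFun_gaussianReal_eq_mul, integral_cexp_neg_mul_sq_div_two hv]
  rw [Complex.ofReal_re, inv_mul_cancel_left₀ (by positivity)]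
  simp only [gaussianPDFReal, sub_sq_comm]

variable [IsFiniteMeasure μ]

lemma tendsto_exp_neg_mul_sq_div_two (t : ℝ) :
    Tendsto (fun v : ℝ≥0 => Real.exp (-(v * t ^ 2 / 2))) (𝓝[≠] 0) (𝓝 1) := by
  have : Continuous fun v : ℝ≥0 => Real.exp (-(v * t ^ 2 / 2)) := by fun_prop
  simpa using (this.tendsto 0).mono_left nhdsWithin_le_nhds

theorem tendsto_integral_gaussianPDFReal (h : Integrable (charFun μ)) (x : ℝ) :
    Tendsto (fun v : ℝ≥0 => ((2 * π * ∫ y, gaussianPDFReal x v y ∂μ : ℝ) : ℂ)) (𝓝[≠] 0)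
      (𝓝 (∫ t : ℝ, Complex.exp (-(t * x * I)) * charFun μ t)) := by
  have hdom : Tendsto (fun v : ℝ≥0 => ∫ t : ℝ, Complex.exp (-(t * x * I))
      * (Real.exp (-(v * t ^ 2 / 2)) * charFun μ t)) (𝓝[≠] 0)
      (𝓝 (∫ t : ℝ, Complex.exp (-(t * x * I)) * charFun μ t)) := by
    refine tendsto_integral_filter_of_dominated_convergence (fun t => ‖charFun μ t‖)
      (Eventually.of_forall fun v => ?_) (Eventually.of_forall fun v => ae_of_all _ fun t => ?_)
      h.norm (ae_of_all _ fun t => ?_)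
    · have := measurable_charFun (μ := μ)
      exact Measurable.aestronglyMeasurable (by fun_prop)
    · rw [norm_mul, norm_mul, norm_cexp_neg_mul_mul_I, one_mul, Complex.norm_real,
        Real.norm_of_nonneg (by positivity)]
      refine mul_le_of_le_one_left (norm_nonneg _) (Real.exp_le_one_iff.2 ?_)
      have : (0 : ℝ) ≤ v * t ^ 2 / 2 := by positivity
      linarith
    · have := (Complex.continuous_ofReal.tendsto 1).comp (tendsto_exp_neg_mul_sq_div_two t)
      simpa using (this.mul_const (charFun μ t)).const_mul (Complex.exp (-(t * x * I)))
  refine hdom.congr' ?_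
  filter_upwards [self_mem_nhdsWithin] with v hv
  exact integral_exp_neg_mul_charFun μ hv x

lemma tendsto_integral_gaussianPDFReal_charFunDensity (h : Integrable (charFun μ)) (x : ℝ) :
    Tendsto (fun v : ℝ≥0 => ∫ y, gaussianPDFReal x v y ∂μ) (𝓝[≠] 0) (𝓝 (charFunDensity μ x)) := by
  have := (Complex.continuous_re.tendsto _).comp (tendsto_integral_gaussianPDFReal h x)
  refine (this.const_mul (2 * π)⁻¹).congr fun v => ?_
  rw [Function.comp_apply, Complex.ofReal_re, inv_mul_cancel_left₀ (by positivity)]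

lemma charFunDensity_nonneg (h : Integrable (charFun μ)) (x : ℝ) : 0 ≤ charFunDensity μ x :=
  ge_of_tendsto' (tendsto_integral_gaussianPDFReal_charFunDensity h x) fun v =>
    integral_nonneg fun y => gaussianPDFReal_nonneg x v y

lemma ofReal_charFunDensity (h : Integrable (charFun μ)) (x : ℝ) :
    (charFunDensity μ x : ℂ)
      = ((2 * π : ℝ) : ℂ)⁻¹ * ∫ t : ℝ, Complex.exp (-(t * x * I)) * charFun μ t := by
  have him : (∫ t : ℝ, Complex.exp (-(t * x * I)) * charFun μ t).im = 0 :=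
    tendsto_nhds_unique ((Complex.continuous_im.tendsto _).comp
      (tendsto_integral_gaussianPDFReal h x)) (by simp [Function.comp_def])
  rw [charFunDensity, ← Complex.ofReal_inv, Complex.ofReal_mul]
  congr 1
  exact Complex.ext (by simp) (by simp [him])

lemma lintegral_charFunDensity_le (h : Integrable (charFun μ)) :
    ∫⁻ x, ENNReal.ofReal (charFunDensity μ x) ≤ μ univ := by
  have hcont : ∀ v : ℝ≥0, Continuous fun p : ℝ × ℝ => gaussianPDFReal p.1 v p.2 := fun v => by
    unfold gaussianPDFReal
    fun_prop
  have hint : ∀ (v : ℝ≥0) (x : ℝ), ENNReal.ofReal (∫ y, gaussianPDFReal x v y ∂μ)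
      = ∫⁻ y, gaussianPDF x v y ∂μ := fun v x => by
    refine ofReal_integral_eq_lintegral_ofReal ?_ (ae_of_all _ (gaussianPDFReal_nonneg x v))
    refine (integrable_const ((√(2 * π * v))⁻¹)).mono'
      (measurable_gaussianPDFReal x v).aestronglyMeasurable (ae_of_all _ fun y => ?_)
    rw [Real.norm_of_nonneg (gaussianPDFReal_nonneg x v y)]
    refine mul_le_of_le_one_right (by positivity) (Real.exp_le_one_iff.2 ?_)
    rw [neg_div]
    exact neg_nonpos.2 (by positivity)
  have hmass : ∀ v : ℝ≥0, v ≠ 0 → ∫⁻ x, ∫⁻ y, gaussianPDF x v y ∂μ = μ univ := fun v hv => by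
    rw [lintegral_lintegral_swap]
    · have : ∀ x y : ℝ, gaussianPDF x v y = gaussianPDF y v x := fun x y => by
        simp only [gaussianPDF, gaussianPDFReal, sub_sq_comm]
      simp_rw [fun y x => this x y, lintegral_gaussianPDF_eq_one _ hv, lintegral_one]
    · exact ((hcont v).measurable.ennreal_ofReal).aemeasurable
  calc ∫⁻ x, ENNReal.ofReal (charFunDensity μ x)
      = ∫⁻ x, liminf (fun v : ℝ≥0 => ∫⁻ y, gaussianPDF x v y ∂μ) (𝓝[≠] 0) := by
        refine lintegral_congr fun x => ?_
        simp_rw [← hint]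
        exact ((ENNReal.tendsto_ofReal
          (tendsto_integral_gaussianPDFReal_charFunDensity h x)).liminf_eq).symm
    _ ≤ liminf (fun v : ℝ≥0 => ∫⁻ x, ∫⁻ y, gaussianPDF x v y ∂μ) (𝓝[≠] 0) :=
        lintegral_liminf_le fun v => ((hcont v).measurable.ennreal_ofReal).lintegral_prod_right'
    _ = μ univ := by
        refine (tendsto_const_nhds.congr' ?_).liminf_eq
        filter_upwards [self_mem_nhdsWithin] with v hv using (hmass v hv).symm

lemma integrable_charFunDensity (h : Integrable (charFun μ)) : Integrable (charFunDensity μ) := by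
  refine ⟨(continuous_charFunDensity h).aestronglyMeasurable, ?_⟩
  rw [hasFiniteIntegral_iff_ofReal (ae_of_all _ (charFunDensity_nonneg h))]
  exact (lintegral_charFunDensity_le h).trans_lt (measure_lt_top μ univ)

lemma fourier_charFun_two_pi_mul (h : Integrable (charFun μ)) :
    𝓕 (fun t : ℝ => charFun μ (2 * π * t)) = fun x => (charFunDensity μ x : ℂ) := by
  funext x
  rw [ofReal_charFunDensity h, Real.fourier_real_eq_integral_exp_smul]
  have hscale := Measure.integral_comp_mul_left
    (fun t : ℝ => Complex.exp (-(t * x * I)) * charFun μ t) (2 * π)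
  rw [abs_of_pos (by positivity), Complex.real_smul, Complex.ofReal_inv] at hscale
  rw [← hscale]
  refine integral_congr_ae (ae_of_all _ fun t => ?_)
  simp only [smul_eq_mul]
  congr 2
  push_cast
  ring

theorem withDensity_charFunDensity (h : Integrable (charFun μ)) :
    volume.withDensity (fun x => ENNReal.ofReal (charFunDensity μ x)) = μ := by
  have hfin := isFiniteMeasure_withDensity_ofReal (integrable_charFunDensity h).2
  refine Measure.ext_of_charFun (funext fun t => ?_)
  have hcont : Continuous fun t : ℝ => charFun μ (2 * π * t) :=
    continuous_charFun.comp (by fun_prop)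
  have hF := fourier_charFun_two_pi_mul h
  have hinv := congrFun (hcont.fourierInv_fourier_eq (h.comp_mul_left' (by positivity))
    (hF ▸ (integrable_charFunDensity h).ofReal)) (t / (2 * π))
  rw [hF, mul_div_cancel₀ t (by positivity : 2 * π ≠ 0)] at hinv
  rw [← hinv, Real.fourierInv_eq', charFun_apply_real,
    integral_withDensity_eq_integral_toReal_smul
      (continuous_charFunDensity h).measurable.ennreal_ofReal (ae_of_all _ fun x => by simp)]
  refine integral_congr_ae (ae_of_all _ fun x => ?_)
  simp only [ENNReal.toReal_ofReal (charFunDensity_nonneg h x), Complex.real_smul, smul_eq_mul,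
    mul_comm (charFunDensity μ x : ℂ)]
  congr 2
  simp
  field_simp

end FourierInversion

section Plancherel

variable {μ : Measure ℝ} {B : ℝ≥0}

lemma integral_gaussianPDFReal_le (hB : μ ≤ B • (volume : Measure ℝ)) (x : ℝ) {v : ℝ≥0}
    (hv : v ≠ 0) : ∫ y, gaussianPDFReal x v y ∂μ ≤ B := by
  calc _ ≤ ∫ y, gaussianPDFReal x v y ∂(B • (volume : Measure ℝ)) :=
        integral_mono_measure hB (ae_of_all _ (gaussianPDFReal_nonneg x v))
          ((integrable_gaussianPDFReal x v).smul_measure_nnreal)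
    _ = B := by
        rw [integral_smul_nnreal_measure, integral_gaussianPDFReal_eq_one _ hv, NNReal.smul_def,
          smul_eq_mul, mul_one]

variable [IsFiniteMeasure μ]

theorem lintegral_charFun_le_of_nonneg (hB : μ ≤ B • (volume : Measure ℝ)) {f : ℝ → ℝ}
    (hf : ∀ t, charFun μ t = f t) (hf0 : ∀ t, 0 ≤ f t) :
    ∫⁻ t, ENNReal.ofReal (f t) ≤ ENNReal.ofReal (2 * π * B) := by
  have hfm : Measurable f := by
    have : f = fun t => (charFun μ t).re := funext fun t => by simp [hf]
    rw [this]
    exact Complex.measurable_re.comp measurable_charFun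
  have hweight : ∀ v : ℝ≥0, v ≠ 0 →
      ∫⁻ t, ENNReal.ofReal (Real.exp (-(v * t ^ 2 / 2)) * f t) ≤ ENNReal.ofReal (2 * π * B) := by
    intro v hv
    have h := integral_exp_neg_mul_charFun μ hv 0
    simp only [hf, Complex.ofReal_zero, mul_zero, zero_mul, neg_zero, Complex.exp_zero, one_mul,
      ← Complex.ofReal_mul, integral_complex_ofReal, Complex.ofReal_inj] at h
    have hint : Integrable fun t : ℝ => Real.exp (-(v * t ^ 2 / 2)) * f t := by
      have hg := integrable_exp_neg_mul_sq (b := (v / 2 : ℝ)) (by positivity)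
      refine (hg.mul_const (μ.real univ)).mono' (by fun_prop) (ae_of_all _ fun t => ?_)
      rw [norm_mul, Real.norm_of_nonneg (by positivity), neg_mul, div_mul_eq_mul_div]
      gcongr
      simpa [hf] using norm_charFun_le (μ := μ) t
    rw [← ofReal_integral_eq_lintegral_ofReal hint
      (ae_of_all _ fun t => mul_nonneg (by positivity) (hf0 t)), h]
    gcongr
    exact integral_gaussianPDFReal_le hB 0 hv
  calc ∫⁻ t, ENNReal.ofReal (f t)
      = ∫⁻ t, liminf (fun v : ℝ≥0 => ENNReal.ofReal (Real.exp (-(v * t ^ 2 / 2)) * f t))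
          (𝓝[≠] 0) := by
        refine lintegral_congr fun t => ?_
        have := (tendsto_exp_neg_mul_sq_div_two t).mul_const (f t)
        rw [one_mul] at this
        exact (ENNReal.tendsto_ofReal this).liminf_eq.symm
    _ ≤ liminf (fun v : ℝ≥0 => ∫⁻ t, ENNReal.ofReal (Real.exp (-(v * t ^ 2 / 2)) * f t))
          (𝓝[≠] 0) := lintegral_liminf_le fun v => by fun_prop
    _ ≤ ENNReal.ofReal (2 * π * B) := by
        refine (liminf_le_liminf ?_).trans (liminf_const _).le
        filter_upwards [self_mem_nhdsWithin] with v hv using hweight v hv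

lemma conv_le_smul_volume (ν : Measure ℝ) [IsFiniteMeasure ν] (hB : μ ≤ B • (volume : Measure ℝ)) :
    ν ∗ μ ≤ (B * (ν univ).toNNReal) • (volume : Measure ℝ) := by
  refine Measure.le_iff.2 fun s hs => ?_
  rw [← lintegral_indicator_one hs, Measure.lintegral_conv (by fun_prop (disch := exact hs))]
  calc ∫⁻ x, ∫⁻ y, s.indicator 1 (x + y) ∂μ ∂ν
      ≤ ∫⁻ x, ∫⁻ y, s.indicator 1 (x + y) ∂(B • volume) ∂ν := by gcongr
    _ = ∫⁻ _, B * volume s ∂ν := by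
        refine lintegral_congr fun x => ?_
        rw [ENNReal.smul_def, lintegral_smul_measure, lintegral_add_left_eq_self (s.indicator 1),
          lintegral_indicator_one hs, smul_eq_mul]
    _ = ((B * (ν univ).toNNReal) • (volume : Measure ℝ)) s := by
        rw [lintegral_const, ENNReal.smul_def, Measure.smul_apply, smul_eq_mul, ENNReal.coe_mul,
          ENNReal.coe_toNNReal (measure_ne_top ν univ), mul_right_comm]

lemma charFun_map_neg_conv_self (μ : Measure ℝ) [IsFiniteMeasure μ] (t : ℝ) :
    charFun (μ.map (-1 * ·) ∗ μ) t = (‖charFun μ t‖ ^ 2 : ℝ) := by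
  rw [charFun_conv, charFun_map_mul, neg_one_mul, charFun_neg, mul_comm, Complex.mul_conj,
    Complex.normSq_eq_norm_sq]

theorem lintegral_normSq_charFun_le (hB : μ ≤ B • (volume : Measure ℝ)) :
    ∫⁻ t, ENNReal.ofReal (‖charFun μ t‖ ^ 2) ≤ ENNReal.ofReal (2 * π * (B * μ.real univ)) := by
  have h := lintegral_charFun_le_of_nonneg (conv_le_smul_volume (μ.map (-1 * ·)) hB)
    (charFun_map_neg_conv_self μ) (fun t => by positivity)
  rwa [Measure.map_apply (by fun_prop) .univ, preimage_univ] at h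

lemma integrable_normSq_charFun (hB : μ ≤ B • (volume : Measure ℝ)) :
    Integrable fun t => ‖charFun μ t‖ ^ 2 := by
  refine ⟨(continuous_charFun.norm.pow 2).aestronglyMeasurable, ?_⟩
  rw [hasFiniteIntegral_iff_ofReal (ae_of_all _ fun t => by positivity)]
  exact (lintegral_normSq_charFun_le hB).trans_lt ENNReal.ofReal_lt_top

theorem integral_normSq_charFun_le (hB : μ ≤ B • (volume : Measure ℝ)) :
    ∫ t, ‖charFun μ t‖ ^ 2 ≤ 2 * π * (B * μ.real univ) := by
  rw [integral_eq_lintegral_of_nonneg_ae (ae_of_all _ fun t => by positivity)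
    (integrable_normSq_charFun hB).aestronglyMeasurable]
  exact ENNReal.toReal_le_of_le_ofReal (by positivity) (lintegral_normSq_charFun_le hB)

end Plancherel

section ComplexExp

lemma norm_cexp_sub_cexp_le {z w : ℂ} {M : ℝ} (hz : z.re ≤ M) (hw : w.re ≤ M) :
    ‖Complex.exp z - Complex.exp w‖ ≤ Real.exp M * ‖z - w‖ := by
  refine (convex_halfSpace_re_le M).norm_image_sub_le_of_norm_hasDerivWithin_le
    (f := Complex.exp) (f' := Complex.exp)
    (fun x _ => (Complex.hasDerivAt_exp x).hasDerivWithinAt) (fun x hx => ?_) hw hz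
  rw [Complex.norm_exp]
  exact Real.exp_le_exp.2 hx

lemma norm_cexp_sub_cexp_sub_mul_le {z w : ℂ} {M : ℝ} (hz : z.re ≤ M) (hw : w.re ≤ M) :
    ‖Complex.exp z - Complex.exp w - (z - w) * Complex.exp w‖ ≤ Real.exp M * ‖z - w‖ ^ 2 := by
  have hderiv : ∀ x ∈ segment ℝ w z,
      HasDerivWithinAt (fun u => Complex.exp u - u * Complex.exp w)
        (Complex.exp x - Complex.exp w) (segment ℝ w z) x := fun x _ =>
    ((Complex.hasDerivAt_exp x).sub
      (by simpa using (hasDerivAt_id x).mul_const (Complex.exp w))).hasDerivWithinAt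
  have hderiv_le : ∀ x ∈ segment ℝ w z,
      ‖Complex.exp x - Complex.exp w‖ ≤ Real.exp M * ‖z - w‖ := by
    intro x hx
    have hxM : x.re ≤ M := (convex_halfSpace_re_le M).segment_subset hw hz hx
    refine (norm_cexp_sub_cexp_le hxM hw).trans ?_
    gcongr
    exact norm_sub_le_of_mem_segment hx
  calc _ = ‖Complex.exp z - z * Complex.exp w - (Complex.exp w - w * Complex.exp w)‖ := by
        congr 1; ring
    _ ≤ Real.exp M * ‖z - w‖ * ‖z - w‖ :=
        (convex_segment w z).norm_image_sub_le_of_norm_hasDerivWithin_le hderiv hderiv_le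
          (left_mem_segment ℝ w z) (right_mem_segment ℝ w z)
    _ = _ := by ring

lemma norm_cexp_sub_one_sub_le {z : ℂ} {M : ℝ} (hz : z.re ≤ M) (hM : 0 ≤ M) :
    ‖Complex.exp z - 1 - z‖ ≤ Real.exp M * ‖z‖ ^ 2 := by
  simpa using norm_cexp_sub_cexp_sub_mul_le (w := 0) hz (by simpa using hM)

end ComplexExp

section CompoundPoisson

variable {μ : Measure ℝ}

/-- The `n`-fold convolution power of `μ`. -/
noncomputable def convPow (μ : Measure ℝ) : ℕ → Measure ℝ
  | 0 => Measure.dirac 0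
  | n + 1 => convPow μ n ∗ μ

/-- The part with at least two jumps of the compound Poisson law with jump measure `μ`. The part
with one jump is left out because its characteristic function need not be integrable. -/
noncomputable def multiJumpPart (μ : Measure ℝ) : Measure ℝ :=
  Measure.sum fun n => ENNReal.ofReal (Real.exp (-μ.real univ) / (n + 2).factorial) •
    convPow μ (n + 2)

lemma re_charFun_le (μ : Measure ℝ) (t : ℝ) : (charFun μ t).re ≤ μ.real univ :=
  (Complex.re_le_norm _).trans (norm_charFun_le t)

variable [IsFiniteMeasure μ]

instance isFiniteMeasure_convPow (n : ℕ) : IsFiniteMeasure (convPow μ n) := by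
  induction n with
  | zero => exact inferInstanceAs (IsFiniteMeasure (Measure.dirac 0))
  | succ n _ => exact inferInstanceAs (IsFiniteMeasure (convPow μ n ∗ μ))

lemma charFun_convPow (n : ℕ) (t : ℝ) : charFun (convPow μ n) t = charFun μ t ^ n := by
  induction n with
  | zero => simp [convPow]
  | succ n ih => rw [convPow, charFun_conv, ih, pow_succ]

lemma measureReal_convPow_univ (n : ℕ) : (convPow μ n).real univ = μ.real univ ^ n := by
  have h := charFun_convPow (μ := μ) n 0
  rw [charFun_zero, charFun_zero] at h
  exact_mod_cast h

lemma integrable_multiJumpPart {f : ℝ → ℂ} (hf : Measurable f) (hf1 : ∀ x, ‖f x‖ = 1) :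
    Integrable f (multiJumpPart μ) := by
  refine integrable_sum_measure (fun n => ?_) ?_
  · exact ((integrable_const (1 : ℝ)).mono' hf.aestronglyMeasurable
      (ae_of_all _ fun x => (hf1 x).le)).smul_measure ENNReal.ofReal_ne_top
  · have h := ((summable_nat_add_iff 2).2 (Real.summable_pow_div_factorial (μ.real univ))).mul_left
      (Real.exp (-μ.real univ))
    refine h.congr fun n => ?_
    rw [integral_smul_measure, ENNReal.toReal_ofReal (by positivity)]
    simp only [hf1, integral_const, measureReal_convPow_univ, smul_eq_mul, mul_one]
    ring

instance isFiniteMeasure_multiJumpPart : IsFiniteMeasure (multiJumpPart μ) := by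
  have h := integrable_multiJumpPart (μ := μ) (f := fun _ => 1) measurable_const (by simp)
  simpa using (integrable_const_iff.1 h)

theorem charFun_multiJumpPart (μ : Measure ℝ) [IsFiniteMeasure μ] (t : ℝ) :
    charFun (multiJumpPart μ) t
      = Real.exp (-μ.real univ) * (Complex.exp (charFun μ t) - 1 - charFun μ t) := by
  have hint := integrable_multiJumpPart (μ := μ) (f := fun x => Complex.exp (t * x * I))
    (by fun_prop) fun x => by simpa using Complex.norm_exp_ofReal_mul_I (t * x)
  have hsum : HasSum (fun n : ℕ => (Real.exp (-μ.real univ) : ℂ)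
      * (charFun μ t ^ (n + 2) / (n + 2).factorial))
      (Real.exp (-μ.real univ) * (Complex.exp (charFun μ t) - 1 - charFun μ t)) := by
    refine HasSum.mul_left _ ?_
    rw [Complex.exp_eq_exp_ℂ, sub_sub]
    simpa [Finset.sum_range_succ] using
      (hasSum_nat_add_iff' 2).2 (NormedSpace.expSeries_div_hasSum_exp (charFun μ t))
  rw [charFun_apply_real]
  refine (hasSum_integral_measure hint).tsum_eq.symm.trans
    ((tsum_congr fun n => ?_).trans hsum.tsum_eq)
  rw [integral_smul_measure, ← charFun_apply_real, charFun_convPow,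
    ENNReal.toReal_ofReal (by positivity), Complex.real_smul]
  push_cast
  ring

lemma norm_charFun_multiJumpPart_le {t D : ℝ} (hD : D ≤ μ.real univ)
    (h : (charFun μ t).re ≤ μ.real univ - D) :
    ‖charFun (multiJumpPart μ) t‖ ≤ Real.exp (-D) * ‖charFun μ t‖ ^ 2 := by
  rw [charFun_multiJumpPart, norm_mul, Complex.norm_real, Real.norm_of_nonneg (by positivity)]
  calc _ ≤ Real.exp (-μ.real univ) * (Real.exp (μ.real univ - D) * ‖charFun μ t‖ ^ 2) := by
        gcongr
        exact norm_cexp_sub_one_sub_le h (by linarith)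
    _ = _ := by
        rw [← mul_assoc, ← Real.exp_add]
        ring_nf

lemma integrable_charFun_multiJumpPart {B : ℝ≥0} (hB : μ ≤ B • (volume : Measure ℝ)) :
    Integrable (charFun (multiJumpPart μ)) := by
  refine (integrable_normSq_charFun hB).mono' measurable_charFun.aestronglyMeasurable
    (ae_of_all _ fun t => ?_)
  simpa using norm_charFun_multiJumpPart_le (D := 0) measureReal_nonneg
    (by simpa using re_charFun_le μ t)

/-- The density, off the atom at `0`, of the compound Poisson law whose jump measure has
density `h`. -/
noncomputable def compoundPoissonDensity (h : ℝ → ℝ) (x : ℝ) : ℝ :=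
  let μ := volume.withDensity fun x => ENNReal.ofReal (h x)
  Real.exp (-μ.real univ) * h x + charFunDensity (multiJumpPart μ) x

lemma compoundPoissonDensity_nonneg {h : ℝ → ℝ} {B : ℝ≥0} (h0 : ∀ x, 0 ≤ h x)
    (hμ : μ = volume.withDensity fun x => ENNReal.ofReal (h x))
    (hB : μ ≤ B • (volume : Measure ℝ)) (x : ℝ) : 0 ≤ compoundPoissonDensity h x := by
  rw [compoundPoissonDensity, ← hμ]
  exact add_nonneg (mul_nonneg (Real.exp_pos _).le (h0 x))
    (charFunDensity_nonneg (integrable_charFun_multiJumpPart hB) x)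

lemma measurable_compoundPoissonDensity {h : ℝ → ℝ} {B : ℝ≥0} (hm : Measurable h)
    (hμ : μ = volume.withDensity fun x => ENNReal.ofReal (h x))
    (hB : μ ≤ B • (volume : Measure ℝ)) : Measurable (compoundPoissonDensity h) := by
  unfold compoundPoissonDensity
  rw [← hμ]
  exact (hm.const_mul _).add
    (continuous_charFunDensity (integrable_charFun_multiJumpPart hB)).measurable

lemma continuousAt_compoundPoissonDensity {h : ℝ → ℝ} {B : ℝ≥0} {x : ℝ} (hx : ContinuousAt h x)
    (hμ : μ = volume.withDensity fun x => ENNReal.ofReal (h x))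
    (hB : μ ≤ B • (volume : Measure ℝ)) : ContinuousAt (compoundPoissonDensity h) x := by
  unfold compoundPoissonDensity
  rw [← hμ]
  exact (continuousAt_const.mul hx).add
    (continuous_charFunDensity (integrable_charFun_multiJumpPart hB)).continuousAt

theorem eq_atom_add_jump_add_multiJumpPart {ν : Measure ℝ} [IsFiniteMeasure ν]
    (hν : ∀ t, charFun ν t = Complex.exp (charFun μ t - μ.real univ)) :
    ν = ENNReal.ofReal (Real.exp (-μ.real univ)) • (Measure.dirac 0 + μ) + multiJumpPart μ := by
  have : IsFiniteMeasure (ENNReal.ofReal (Real.exp (-μ.real univ)) • (Measure.dirac 0 + μ)) :=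
    Measure.smul_finite _ ENNReal.ofReal_ne_top
  have hint : ∀ (κ : Measure ℝ) [IsFiniteMeasure κ] (t : ℝ),
      Integrable (fun x : ℝ => Complex.exp (t * x * I)) κ := fun κ _ t =>
    (integrable_const (1 : ℝ)).mono' (by fun_prop)
      (ae_of_all _ fun x => by simpa using (Complex.norm_exp_ofReal_mul_I (t * x)).le)
  refine Measure.ext_of_charFun (funext fun t => ?_)
  rw [charFun_apply_real (μ := _ + _), integral_add_measure (hint _ t) (hint _ t),
    integral_smul_measure, integral_add_measure (hint _ t) (hint _ t), ← charFun_apply_real,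
    ← charFun_apply_real, ← charFun_apply_real, charFun_multiJumpPart, hν, sub_eq_add_neg,
    Complex.exp_add, ENNReal.toReal_ofReal (by positivity), Complex.real_smul, charFun_dirac]
  push_cast
  simp
  ring

theorem compoundPoisson_eq_dirac_add_withDensity {ν : Measure ℝ} [IsFiniteMeasure ν] {h : ℝ → ℝ}
    {B : ℝ≥0} (hm : Measurable h) (h0 : ∀ x, 0 ≤ h x)
    (hμ : μ = volume.withDensity fun x => ENNReal.ofReal (h x))
    (hB : μ ≤ B • (volume : Measure ℝ))
    (hν : ∀ t, charFun ν t = Complex.exp (charFun μ t - μ.real univ)) :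
    ν = ENNReal.ofReal (Real.exp (-μ.real univ)) • Measure.dirac 0
      + volume.withDensity fun x => ENNReal.ofReal (compoundPoissonDensity h x) := by
  have hint := integrable_charFun_multiJumpPart hB
  have hdensity : volume.withDensity (fun x => ENNReal.ofReal (compoundPoissonDensity h x))
      = ENNReal.ofReal (Real.exp (-μ.real univ)) • μ + multiJumpPart μ := by
    conv_rhs => rw [← withDensity_charFunDensity hint]
    nth_rw 2 [hμ]
    rw [← withDensity_smul _ hm.ennreal_ofReal, ← withDensity_add_left (by fun_prop)]
    refine congrArg _ (funext fun x => ?_)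
    rw [compoundPoissonDensity, ← hμ, ENNReal.ofReal_add (mul_nonneg (by positivity) (h0 x))
      (charFunDensity_nonneg hint x), ENNReal.ofReal_mul (by positivity)]
    rfl
  rw [hdensity, ← add_assoc, ← smul_add]
  exact eq_atom_add_jump_add_multiJumpPart hν

end CompoundPoisson

section ExponentialTilt

variable {ν κ : Measure ℝ}

/-- The unnormalised exponential tilt `exp (β x) κ(dx)`. It is the jump measure of the Cramér
`β`-tilt of the compound Poisson law with jump measure `κ`. -/
noncomputable def expTilt (κ : Measure ℝ) (β : ℝ) : Measure ℝ :=
  κ.withDensity fun x => ENNReal.ofReal (Real.exp (β * x))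

lemma integrableExpSet_eq_univ_of_mgf {c : ℝ → ℝ} (h : ∀ θ, mgf id ν θ = Real.exp (c θ)) :
    integrableExpSet id ν = univ := by
  refine eq_univ_of_forall fun θ => ?_
  by_contra hθ
  have hzero := mgf_undef (X := id) (μ := ν) hθ
  rw [h θ] at hzero
  exact (Real.exp_pos _).ne' hzero

lemma complexMGF_eq_cexp_of_mgf (hκ : integrableExpSet id κ = univ)
    (h : ∀ θ, mgf id ν θ = Real.exp (mgf id κ θ - κ.real univ)) (z : ℂ) :
    complexMGF id ν z = Complex.exp (complexMGF id κ z - κ.real univ) := by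
  have hν := integrableExpSet_eq_univ_of_mgf h
  have hanν : AnalyticOnNhd ℂ (complexMGF id ν) univ := by
    simpa [hν] using analyticOnNhd_complexMGF (X := id) (μ := ν)
  have hanκ : AnalyticOnNhd ℂ (complexMGF id κ) univ := by
    simpa [hκ] using analyticOnNhd_complexMGF (X := id) (μ := κ)
  have hreal : ∀ x : ℝ, complexMGF id ν x = Complex.exp (complexMGF id κ x - κ.real univ) := by
    intro x
    rw [complexMGF_ofReal, complexMGF_ofReal, h]
    push_cast
    rfl
  have htendsto : Tendsto (fun x : ℝ => (x : ℂ)) (𝓝[≠] 0) (𝓝[≠] 0) := by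
    refine tendsto_nhdsWithin_of_tendsto_nhds_of_eventually_within _ ?_ ?_
    · simpa using (Complex.continuous_ofReal.tendsto 0).mono_left nhdsWithin_le_nhds
    · filter_upwards [self_mem_nhdsWithin] with x hx
      simpa using hx
  exact hanν.eqOn_of_preconnected_of_frequently_eq (hanκ.sub analyticOnNhd_const).cexp
    isPreconnected_univ (mem_univ 0)
    (htendsto.frequently (Eventually.of_forall hreal).frequently) (mem_univ z)

lemma integral_expTilt {E : Type*} [NormedAddCommGroup E] [NormedSpace ℝ E] (β : ℝ) (f : ℝ → E) :
    ∫ x, f x ∂(expTilt κ β) = ∫ x, Real.exp (β * x) • f x ∂κ := by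
  rw [expTilt, integral_withDensity_eq_integral_toReal_smul (by fun_prop)
    (ae_of_all _ fun x => by simp)]
  simp only [ENNReal.toReal_ofReal (Real.exp_pos _).le]

lemma charFun_expTilt (β t : ℝ) : charFun (expTilt κ β) t = complexMGF id κ (β + t * I) := by
  rw [charFun_apply_real, integral_expTilt, complexMGF]
  refine integral_congr_ae (ae_of_all _ fun x => ?_)
  simp only [id, Complex.real_smul, Complex.ofReal_exp, ← Complex.exp_add]
  push_cast
  ring_nf

lemma measureReal_expTilt_univ (β : ℝ) : (expTilt κ β).real univ = mgf id κ β := by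
  simpa [mgf] using integral_expTilt (κ := κ) β fun _ => (1 : ℝ)

theorem charFun_cramerTilt (hκ : integrableExpSet id κ = univ)
    (h : ∀ θ, mgf id ν θ = Real.exp (mgf id κ θ - κ.real univ)) (β t : ℝ) :
    charFun (cramerTilt ν β) t
      = Complex.exp (charFun (expTilt κ β) t - (expTilt κ β).real univ) := by
  calc charFun (cramerTilt ν β) t
      = ∫ x : ℝ, (Real.exp (β * x) / mgf id ν β) • Complex.exp (t * x * I) ∂ν := by
        rw [charFun_apply_real]
        exact integral_tilted_mul_eq_mgf (X := id) _
    _ = (mgf id ν β : ℂ)⁻¹ * complexMGF id ν (β + t * I) := by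
        rw [complexMGF, ← integral_const_mul]
        refine integral_congr_ae (ae_of_all _ fun x => ?_)
        simp only [id, Complex.real_smul, add_mul, Complex.exp_add]
        push_cast
        ring_nf
    _ = _ := by
        rw [complexMGF_eq_cexp_of_mgf hκ h, h, charFun_expTilt, measureReal_expTilt_univ,
          Complex.ofReal_exp, ← Complex.exp_neg, ← Complex.exp_add]
        push_cast
        ring_nf

lemma cgf_eq_of_mgf (h : ∀ θ, mgf id ν θ = Real.exp (mgf id κ θ - κ.real univ)) :
    cgf id ν = fun θ => mgf id κ θ - κ.real univ := by
  funext θ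
  rw [cgf, h, Real.log_exp]

theorem tiltMean_eq_integral_expTilt (hκ : integrableExpSet id κ = univ)
    (h : ∀ θ, mgf id ν θ = Real.exp (mgf id κ θ - κ.real univ)) (β : ℝ) :
    tiltMean ν β = ∫ x, x ∂(expTilt κ β) := by
  have hν := integrableExpSet_eq_univ_of_mgf h
  have hmean := integral_tilted_mul_self (X := id) (μ := ν) (t := β) (by simp [hν])
  rw [cgf_eq_of_mgf h, deriv_sub_const, deriv_mgf (by simp [hκ])] at hmean
  simpa only [tiltMean, cramerTilt, integral_expTilt, smul_eq_mul, mul_comm, id] using hmean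

theorem variance_cramerTilt_eq_integral_expTilt (hκ : integrableExpSet id κ = univ)
    (h : ∀ θ, mgf id ν θ = Real.exp (mgf id κ θ - κ.real univ)) (β : ℝ) :
    variance (fun t : ℝ => t) (cramerTilt ν β) = ∫ x, x ^ 2 ∂(expTilt κ β) := by
  have hν := integrableExpSet_eq_univ_of_mgf h
  have hvar := variance_tilted_mul (X := id) (μ := ν) (t := β) (by simp [hν])
  have hderiv : deriv (fun θ => mgf id κ θ - κ.real univ) = deriv (mgf id κ) :=
    funext fun θ => deriv_sub_const _
  rw [cgf_eq_of_mgf h, iteratedDeriv_succ', hderiv, ← iteratedDeriv_succ',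
    iteratedDeriv_mgf (by simp [hκ])] at hvar
  rw [integral_expTilt]
  simp only [smul_eq_mul, mul_comm (Real.exp _)]
  exact hvar

end ExponentialTilt

section UnitIntervalSupport

variable {μ : Measure ℝ} [IsFiniteMeasure μ]

lemma integrable_of_ae_mem_Icc {E : Type*} [NormedAddCommGroup E] (hμ : ∀ᵐ x ∂μ, x ∈ Icc (0 : ℝ) 1)
    {f : ℝ → E} (hf : Continuous f) : Integrable f μ := by
  obtain ⟨C, hC⟩ := (isCompact_Icc (a := (0 : ℝ)) (b := 1)).exists_bound_of_continuousOn
    hf.continuousOn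
  exact (integrable_const C).mono' hf.aestronglyMeasurable (hμ.mono hC)

lemma re_charFun (t : ℝ) : (charFun μ t).re = ∫ x, Real.cos (t * x) ∂μ := by
  have hint : Integrable (fun x : ℝ => Complex.exp (t * x * I)) μ :=
    (integrable_const (1 : ℝ)).mono' (by fun_prop)
      (ae_of_all _ fun x => by simpa using (Complex.norm_exp_ofReal_mul_I (t * x)).le)
  rw [charFun_apply_real, ← RCLike.re_eq_complex_re, ← integral_re hint]
  simp only [← Complex.ofReal_mul, RCLike.re_eq_complex_re, Complex.exp_ofReal_mul_I_re]

lemma norm_charFun_sub_sum_le (hμ : ∀ᵐ x ∂μ, x ∈ Icc (0 : ℝ) 1) (n : ℕ) (t : ℝ) :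
    ‖charFun μ t - ∑ k ∈ Finset.range n,
        (t * I) ^ k / (k.factorial : ℂ) * ((∫ x, x ^ k ∂μ : ℝ) : ℂ)‖
      ≤ Real.exp |t| * |t| ^ n * ∫ x, x ^ n ∂μ := by
  have hcont : ∀ k : ℕ, Continuous fun x : ℝ => (t * x * I) ^ k / (k.factorial : ℂ) :=
    fun k => by fun_prop
  have hdiff : charFun μ t - ∑ k ∈ Finset.range n,
        (t * I) ^ k / (k.factorial : ℂ) * ((∫ x, x ^ k ∂μ : ℝ) : ℂ)
      = ∫ x : ℝ, (Complex.exp (t * x * I)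
        - ∑ k ∈ Finset.range n, (t * x * I) ^ k / (k.factorial : ℂ)) ∂μ := by
    rw [integral_sub (integrable_of_ae_mem_Icc hμ (by fun_prop))
      (integrable_of_ae_mem_Icc hμ (continuous_finsetSum _ fun k _ => hcont k)),
      integral_finsetSum _ (fun k _ => integrable_of_ae_mem_Icc hμ (hcont k)), charFun_apply_real]
    refine congrArg _ (Finset.sum_congr rfl fun k _ => ?_)
    rw [← integral_complex_ofReal, ← integral_const_mul]
    refine integral_congr_ae (ae_of_all _ fun x => ?_)
    push_cast
    ring
  rw [hdiff, ← integral_const_mul]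
  refine norm_integral_le_of_norm_le (integrable_of_ae_mem_Icc hμ (by fun_prop))
    (hμ.mono fun x hx => (Complex.norm_exp_sub_sum_le_norm_mul_exp _ n).trans ?_)
  have hnorm : ‖(t * x * I : ℂ)‖ = |t| * x := by
    rw [norm_mul, norm_mul, Complex.norm_I, Complex.norm_real, Complex.norm_real, mul_one,
      Real.norm_eq_abs, Real.norm_of_nonneg hx.1]
  rw [hnorm, mul_pow, mul_comm, mul_assoc]
  have hxn : 0 ≤ x ^ n := pow_nonneg hx.1 n
  gcongr
  exact mul_le_of_le_one_right (abs_nonneg t) hx.2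

lemma re_charFun_sub_le (hμ : ∀ᵐ x ∂μ, x ∈ Icc (0 : ℝ) 1) {t : ℝ} (ht : |t| ≤ π) :
    (charFun μ t).re - μ.real univ ≤ -(2 / π ^ 2) * t ^ 2 * ∫ x, x ^ 2 ∂μ := by
  have hmass : μ.real univ = ∫ _, (1 : ℝ) ∂μ := by simp
  rw [re_charFun, hmass, ← integral_sub (integrable_of_ae_mem_Icc hμ (by fun_prop))
    (integrable_const _), ← integral_const_mul]
  refine integral_mono_ae (integrable_of_ae_mem_Icc hμ (by fun_prop))
    (integrable_of_ae_mem_Icc hμ (by fun_prop)) (hμ.mono fun x hx => ?_)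
  have htx : |t * x| ≤ π := by
    rw [abs_mul, abs_of_nonneg hx.1]
    exact (mul_le_of_le_one_right (abs_nonneg _) hx.2).trans ht
  calc Real.cos (t * x) - 1 ≤ -(2 / π ^ 2 * (t * x) ^ 2) := by
        linarith [Real.cos_le_one_sub_mul_cos_sq htx]
    _ = _ := by ring

lemma integral_pow_antitone (hμ : ∀ᵐ x ∂μ, x ∈ Icc (0 : ℝ) 1) :
    Antitone fun n : ℕ => ∫ x, x ^ n ∂μ := fun _ _ hmn =>
  integral_mono_ae (integrable_of_ae_mem_Icc hμ (by fun_prop))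
    (integrable_of_ae_mem_Icc hμ (by fun_prop))
    (hμ.mono fun _ hx => pow_le_pow_of_le_one hx.1 hx.2 hmn)

lemma norm_charFun_sub_sum_le_of_abs_le_pi (hμ : ∀ᵐ x ∂μ, x ∈ Icc (0 : ℝ) 1) {n : ℕ} (hn : 2 ≤ n)
    {t : ℝ} (ht : |t| ≤ π) :
    ‖charFun μ t - ∑ k ∈ Finset.range n,
        (t * I) ^ k / (k.factorial : ℂ) * ((∫ x, x ^ k ∂μ : ℝ) : ℂ)‖
      ≤ Real.exp π * ((∫ x, x ^ 2 ∂μ) * |t| ^ n) := by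
  have hmoment_nonneg : 0 ≤ ∫ x, x ^ n ∂μ :=
    integral_nonneg_of_ae (hμ.mono fun x hx => pow_nonneg hx.1 n)
  have hmoment : ∫ x, x ^ n ∂μ ≤ ∫ x, x ^ 2 ∂μ := integral_pow_antitone hμ hn
  calc _ ≤ Real.exp |t| * |t| ^ n * ∫ x, x ^ n ∂μ := norm_charFun_sub_sum_le hμ n t
    _ ≤ Real.exp π * |t| ^ n * ∫ x, x ^ 2 ∂μ :=
        mul_le_mul (mul_le_mul_of_nonneg_right (Real.exp_le_exp.2 ht) (by positivity)) hmoment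
          hmoment_nonneg (by positivity)
    _ = _ := by ring

/-- The logarithm of the characteristic function of the compound Poisson law with jump measure `μ`,
centred at its mean. -/
noncomputable def centredLogCharFun (μ : Measure ℝ) (t : ℝ) : ℂ :=
  charFun μ t - μ.real univ - t * (∫ x, x ∂μ : ℝ) * I

@[fun_prop]
lemma continuous_centredLogCharFun : Continuous (centredLogCharFun μ) := by
  unfold centredLogCharFun
  fun_prop

variable {t : ℝ}

lemma re_centredLogCharFun_le (hμ : ∀ᵐ x ∂μ, x ∈ Icc (0 : ℝ) 1) (ht : |t| ≤ π) :
    (centredLogCharFun μ t).re ≤ -(2 / π ^ 2 * ((∫ x, x ^ 2 ∂μ) * t ^ 2)) := by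
  have hre : (centredLogCharFun μ t).re = (charFun μ t).re - μ.real univ := by
    simp [centredLogCharFun]
  rw [hre]
  exact (re_charFun_sub_le hμ ht).trans_eq (by ring)

lemma norm_centredLogCharFun_add_le (hμ : ∀ᵐ x ∂μ, x ∈ Icc (0 : ℝ) 1) (ht : |t| ≤ π) :
    ‖centredLogCharFun μ t - -((∫ x, x ^ 2 ∂μ) * t ^ 2 / 2 : ℝ)‖
      ≤ Real.exp π * ((∫ x, x ^ 2 ∂μ) * |t| ^ 3) := by
  have h := norm_charFun_sub_sum_le_of_abs_le_pi hμ (n := 3) (by norm_num) ht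
  simp only [Finset.sum_range_succ, Finset.sum_range_zero, Nat.factorial, pow_zero, pow_one,
    integral_const, smul_eq_mul, mul_one] at h
  refine (congrArg _ ?_).trans_le h
  rw [centredLogCharFun, mul_pow, Complex.I_sq]
  push_cast
  ring

lemma norm_centredLogCharFun_add_sub_le (hμ : ∀ᵐ x ∂μ, x ∈ Icc (0 : ℝ) 1) (ht : |t| ≤ π) :
    ‖centredLogCharFun μ t - -((∫ x, x ^ 2 ∂μ) * t ^ 2 / 2 : ℝ)
        - (t * I) ^ 3 / 6 * (∫ x, x ^ 3 ∂μ : ℝ)‖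
      ≤ Real.exp π * ((∫ x, x ^ 2 ∂μ) * t ^ 4) := by
  have h := norm_charFun_sub_sum_le_of_abs_le_pi hμ (n := 4) (by norm_num) ht
  simp only [Finset.sum_range_succ, Finset.sum_range_zero, Nat.factorial, pow_zero, pow_one,
    integral_const, smul_eq_mul, mul_one] at h
  rw [Even.pow_abs (by decide)] at h
  refine (congrArg _ ?_).trans_le h
  rw [centredLogCharFun, mul_pow _ _ 2, Complex.I_sq]
  push_cast
  ring

lemma neg_half_le_neg_two_div_pi_sq {a : ℝ} (ha : 0 ≤ a) : -(a / 2) ≤ -(2 / π ^ 2 * a) := by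
  have h : 2 / π ^ 2 ≤ 1 / 2 := by
    rw [div_le_div_iff₀ (by positivity) two_pos]
    nlinarith [Real.pi_gt_three]
  nlinarith

lemma norm_cexp_centredLogCharFun_sub_le (hμ : ∀ᵐ x ∂μ, x ∈ Icc (0 : ℝ) 1) (ht : |t| ≤ π) :
    ‖Complex.exp (centredLogCharFun μ t) - Real.exp (-((∫ x, x ^ 2 ∂μ) * t ^ 2 / 2))‖
      ≤ Real.exp π * ((∫ x, x ^ 2 ∂μ) * |t| ^ 3)
        * Real.exp (-(2 / π ^ 2 * ((∫ x, x ^ 2 ∂μ) * t ^ 2))) := by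
  have hnonneg : 0 ≤ (∫ x, x ^ 2 ∂μ) * t ^ 2 :=
    mul_nonneg (integral_nonneg fun x => sq_nonneg x) (sq_nonneg t)
  rw [Complex.ofReal_exp, Complex.ofReal_neg, mul_comm (Real.exp π * _)]
  refine (norm_cexp_sub_cexp_le (re_centredLogCharFun_le hμ ht) ?_).trans ?_
  · rw [← Complex.ofReal_neg, Complex.ofReal_re]
    exact neg_half_le_neg_two_div_pi_sq hnonneg
  · gcongr
    exact norm_centredLogCharFun_add_le hμ ht

lemma norm_cexp_centredLogCharFun_sub_sub_le (hμ : ∀ᵐ x ∂μ, x ∈ Icc (0 : ℝ) 1) (ht : |t| ≤ π) :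
    ‖Complex.exp (centredLogCharFun μ t) - Real.exp (-((∫ x, x ^ 2 ∂μ) * t ^ 2 / 2))
        - (t * I) ^ 3 / 6 * (∫ x, x ^ 3 ∂μ : ℝ) * Real.exp (-((∫ x, x ^ 2 ∂μ) * t ^ 2 / 2))‖
      ≤ ((Real.exp π * ((∫ x, x ^ 2 ∂μ) * |t| ^ 3)) ^ 2
          + Real.exp π * ((∫ x, x ^ 2 ∂μ) * t ^ 4))
        * Real.exp (-(2 / π ^ 2 * ((∫ x, x ^ 2 ∂μ) * t ^ 2))) := by
  have hnonneg : 0 ≤ (∫ x, x ^ 2 ∂μ) * t ^ 2 :=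
    mul_nonneg (integral_nonneg fun x => sq_nonneg x) (sq_nonneg t)
  have hre := neg_half_le_neg_two_div_pi_sq hnonneg
  set w : ℂ := -((∫ x, x ^ 2 ∂μ) * t ^ 2 / 2 : ℝ) with hw
  have hw_exp : (Real.exp (-((∫ x, x ^ 2 ∂μ) * t ^ 2 / 2)) : ℂ) = Complex.exp w := by
    rw [Complex.ofReal_exp, Complex.ofReal_neg]
  have hw_norm : ‖Complex.exp w‖ ≤ Real.exp (-(2 / π ^ 2 * ((∫ x, x ^ 2 ∂μ) * t ^ 2))) := by
    rw [← hw_exp, Complex.norm_real, Real.norm_of_nonneg (by positivity)]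
    exact Real.exp_le_exp.2 hre
  rw [hw_exp]
  calc _ = ‖(Complex.exp (centredLogCharFun μ t) - Complex.exp w
          - (centredLogCharFun μ t - w) * Complex.exp w)
        + (centredLogCharFun μ t - w - (t * I) ^ 3 / 6 * (∫ x, x ^ 3 ∂μ : ℝ)) * Complex.exp w‖ := by
        ring_nf
    _ ≤ Real.exp (-(2 / π ^ 2 * ((∫ x, x ^ 2 ∂μ) * t ^ 2)))
            * (Real.exp π * ((∫ x, x ^ 2 ∂μ) * |t| ^ 3)) ^ 2
          + Real.exp π * ((∫ x, x ^ 2 ∂μ) * t ^ 4)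
            * Real.exp (-(2 / π ^ 2 * ((∫ x, x ^ 2 ∂μ) * t ^ 2))) := by
        refine (norm_add_le _ _).trans (add_le_add ?_ ?_)
        · refine (norm_cexp_sub_cexp_sub_mul_le (re_centredLogCharFun_le hμ ht)
            (by rwa [hw, ← Complex.ofReal_neg, Complex.ofReal_re])).trans ?_
          gcongr
          exact norm_centredLogCharFun_add_le hμ ht
        · rw [norm_mul]
          exact mul_le_mul (norm_centredLogCharFun_add_sub_le hμ ht) hw_norm (norm_nonneg _)
            ((norm_nonneg _).trans (norm_centredLogCharFun_add_sub_le hμ ht))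
    _ = _ := by ring

end UnitIntervalSupport

section GaussianMoments

/-- The absolute moment `∫ |t| ^ n * exp (-b t ^ 2) dt` of an unnormalised Gaussian. -/
noncomputable def gaussMoment (b : ℝ) (n : ℕ) : ℝ :=
  ∫ t : ℝ, |t| ^ n * Real.exp (-(b * t ^ 2))

lemma gaussMoment_nonneg (b : ℝ) (n : ℕ) : 0 ≤ gaussMoment b n :=
  integral_nonneg fun t => by positivity

lemma integrable_abs_pow_mul_exp {b : ℝ} (hb : 0 < b) (n : ℕ) :
    Integrable fun t : ℝ => |t| ^ n * Real.exp (-(b * t ^ 2)) := by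
  have h := (integrable_rpow_mul_exp_neg_mul_sq hb (s := n)
    (by linarith [Nat.cast_nonneg (α := ℝ) n])).norm
  simpa only [Real.rpow_natCast, norm_mul, norm_pow, Real.norm_eq_abs, Real.abs_exp, neg_mul]
    using h

variable {b σ : ℝ}

lemma abs_pow_mul_exp_eq_scaled (b : ℝ) (hσ : 0 < σ) (n : ℕ) (t : ℝ) :
    |t| ^ n * Real.exp (-(b * (σ ^ 2 * t ^ 2)))
      = (σ ^ n)⁻¹ * (|σ * t| ^ n * Real.exp (-(b * (σ * t) ^ 2))) := by
  rw [abs_mul, abs_of_pos hσ, mul_pow, mul_pow, mul_assoc, inv_mul_cancel_left₀ (by positivity)]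

lemma integrable_abs_pow_mul_exp_scaled (hb : 0 < b) (hσ : 0 < σ) (n : ℕ) :
    Integrable fun t : ℝ => |t| ^ n * Real.exp (-(b * (σ ^ 2 * t ^ 2))) := by
  simp only [abs_pow_mul_exp_eq_scaled b hσ]
  exact ((integrable_abs_pow_mul_exp hb n).comp_mul_left' hσ.ne').const_mul _

lemma integral_abs_pow_mul_exp_scaled (b : ℝ) (hσ : 0 < σ) (n : ℕ) :
    ∫ t : ℝ, |t| ^ n * Real.exp (-(b * (σ ^ 2 * t ^ 2))) = gaussMoment b n / σ ^ (n + 1) := by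
  simp only [abs_pow_mul_exp_eq_scaled b hσ]
  rw [integral_const_mul, Measure.integral_comp_mul_left
    (fun t => |t| ^ n * Real.exp (-(b * t ^ 2))), abs_of_pos (by positivity), smul_eq_mul,
    gaussMoment]
  field_simp
  ring

end GaussianMoments

section LocalLimit

lemma abs_charFunDensity_sub_le {μ ν : Measure ℝ} [IsFiniteMeasure μ] [IsFiniteMeasure ν]
    (hμ : Integrable (charFun μ)) (hν : Integrable (charFun ν)) {s : Set ℝ} (hs : MeasurableSet s)
    {x K L : ℝ}
    (hK : ‖∫ t in s, Complex.exp (-(t * x * I)) * (charFun μ t - charFun ν t)‖ ≤ K)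
    (hL : ∫ t in sᶜ, ‖charFun μ t - charFun ν t‖ ≤ L) :
    |charFunDensity μ x - charFunDensity ν x| ≤ K + L := by
  have hint : Integrable fun t : ℝ => Complex.exp (-(t * x * I)) * (charFun μ t - charFun ν t) :=
    integrable_cexp_neg_mul (hμ.sub hν) x
  have hdiff : ((charFunDensity μ x - charFunDensity ν x : ℝ) : ℂ) = ((2 * π : ℝ) : ℂ)⁻¹
      * ∫ t : ℝ, Complex.exp (-(t * x * I)) * (charFun μ t - charFun ν t) := by
    rw [Complex.ofReal_sub, ofReal_charFunDensity hμ, ofReal_charFunDensity hν, ← mul_sub,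
      ← integral_sub (integrable_cexp_neg_mul hμ x) (integrable_cexp_neg_mul hν x)]
    simp only [mul_sub]
  have htail : ‖∫ t in sᶜ, Complex.exp (-(t * x * I)) * (charFun μ t - charFun ν t)‖ ≤ L :=
    (norm_integral_le_of_norm_le (hμ.sub hν).norm.integrableOn (ae_of_all _ fun t => by
      rw [norm_mul, norm_cexp_neg_mul_mul_I, one_mul, Pi.sub_apply])).trans hL
  have htotal : ‖∫ t : ℝ, Complex.exp (-(t * x * I)) * (charFun μ t - charFun ν t)‖ ≤ K + L := by
    rw [← integral_add_compl hs hint]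
    exact (norm_add_le _ _).trans (add_le_add hK htail)
  rw [← Real.norm_eq_abs, ← Complex.norm_real, hdiff, norm_mul, norm_inv, Complex.norm_real,
    Real.norm_of_nonneg (by positivity)]
  have hpi : (2 * π)⁻¹ ≤ 1 := inv_le_one_of_one_le₀ (by linarith [Real.pi_gt_three])
  exact (mul_le_of_le_one_left (norm_nonneg _) hpi).trans htotal

lemma norm_charFun_gaussianReal (m : ℝ) (v : ℝ≥0) (t : ℝ) :
    ‖charFun (gaussianReal m v) t‖ = Real.exp (-(v * t ^ 2 / 2)) := by
  rw [charFun_gaussianReal_eq_mul, norm_mul, ← Complex.ofReal_mul, Complex.norm_exp_ofReal_mul_I,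
    mul_one, Complex.norm_real, Real.norm_of_nonneg (Real.exp_pos _).le]

lemma integrable_charFun_gaussianReal (m : ℝ) {v : ℝ≥0} (hv : v ≠ 0) :
    Integrable (charFun (gaussianReal m v)) := by
  have hexp : Integrable fun t : ℝ => Real.exp (-(v * t ^ 2 / 2)) := by
    simpa [neg_mul, div_mul_eq_mul_div] using
      integrable_exp_neg_mul_sq (b := (v / 2 : ℝ)) (by positivity)
  exact hexp.mono' measurable_charFun.aestronglyMeasurable
    (ae_of_all _ fun t => (norm_charFun_gaussianReal m v t).le)

variable {μ : Measure ℝ} [IsFiniteMeasure μ]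

lemma charFun_multiJumpPart_eq_centred (μ : Measure ℝ) [IsFiniteMeasure μ] (t : ℝ) :
    charFun (multiJumpPart μ) t
      = Complex.exp (t * (∫ x, x ∂μ : ℝ) * I) * Complex.exp (centredLogCharFun μ t)
        - Real.exp (-μ.real univ) * (1 + charFun μ t) := by
  have hexp : Complex.exp (t * (∫ x, x ∂μ : ℝ) * I) * Complex.exp (centredLogCharFun μ t)
      = Real.exp (-μ.real univ) * Complex.exp (charFun μ t) := by
    rw [centredLogCharFun, Complex.ofReal_exp, ← Complex.exp_add, ← Complex.exp_add]
    push_cast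
    ring_nf
  rw [charFun_multiJumpPart, hexp]
  ring

lemma setIntegral_Icc_neg_eq_zero_of_odd {f : ℝ → ℂ} (hf : f.Odd) {r : ℝ} (hr : 0 ≤ r) :
    ∫ t in Icc (-r) r, f t = 0 := by
  rw [integral_Icc_eq_integral_Ioc, ← intervalIntegral.integral_of_le (by linarith)]
  have h := intervalIntegral.integral_comp_neg (a := -r) (b := r) f
  simp only [hf.eq, intervalIntegral.integral_neg, neg_neg] at h
  exact self_eq_neg.1 h.symm

variable {σ : ℝ≥0}

lemma le_abs_of_notMem_Icc_neg {r t : ℝ} (ht : t ∉ Icc (-r) r) : r ≤ |t| := by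
  rw [mem_Icc, ← abs_le, not_le] at ht
  exact ht.le

lemma setIntegral_compl_norm_charFun_gaussianReal_le (m : ℝ) (hσ : σ ≠ 0) :
    ∫ t in (Icc (-π) π)ᶜ, ‖charFun (gaussianReal m (σ ^ 2)) t‖ ≤ gaussMoment (1 / 2) 2 / σ ^ 3 := by
  have hσ' : (0 : ℝ) < σ := by positivity
  have hint := integrable_abs_pow_mul_exp_scaled (b := 1 / 2) (by norm_num) hσ' 2
  rw [← integral_abs_pow_mul_exp_scaled _ hσ']
  refine (setIntegral_mono_on (integrable_charFun_gaussianReal m (by positivity)).norm.integrableOn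
    hint.integrableOn measurableSet_Icc.compl fun t ht => ?_).trans
    (setIntegral_le_integral hint (ae_of_all _ fun t => by positivity))
  have ht_one : 1 ≤ |t| := by linarith [le_abs_of_notMem_Icc_neg ht, Real.pi_gt_three]
  rw [norm_charFun_gaussianReal]
  calc Real.exp (-((σ ^ 2 : ℝ≥0) * t ^ 2 / 2)) = Real.exp (-(1 / 2 * (σ ^ 2 * t ^ 2))) := by
        push_cast
        ring_nf
    _ ≤ _ := le_mul_of_one_le_left (Real.exp_pos _).le (one_le_pow₀ ht_one)

lemma setIntegral_compl_norm_charFun_multiJumpPart_le {B : ℝ≥0}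
    (hB : μ ≤ B • (volume : Measure ℝ)) {δ : ℝ} (hδ : δ ≤ μ.real univ)
    (hdecay : ∀ t, π ≤ |t| → (charFun μ t).re ≤ μ.real univ - δ) :
    ∫ t in (Icc (-π) π)ᶜ, ‖charFun (multiJumpPart μ) t‖
      ≤ Real.exp (-δ) * (2 * π * (B * μ.real univ)) := by
  have hsq := (integrable_normSq_charFun hB).const_mul (Real.exp (-δ))
  calc _ ≤ ∫ t in (Icc (-π) π)ᶜ, Real.exp (-δ) * ‖charFun μ t‖ ^ 2 :=
        setIntegral_mono_on (integrable_charFun_multiJumpPart hB).norm.integrableOn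
          hsq.integrableOn measurableSet_Icc.compl fun t ht =>
          norm_charFun_multiJumpPart_le hδ (hdecay t (le_abs_of_notMem_Icc_neg ht))
    _ ≤ ∫ t, Real.exp (-δ) * ‖charFun μ t‖ ^ 2 :=
        setIntegral_le_integral hsq (ae_of_all _ fun t => by positivity)
    _ ≤ _ := by
        rw [integral_const_mul]
        gcongr
        exact integral_normSq_charFun_le hB

lemma norm_setIntegral_charFun_sub_le {x K : ℝ} (hvar : ∫ y, y ^ 2 ∂μ = σ ^ 2)
    (hK : ‖∫ t in Icc (-π) π, Complex.exp (-(t * (x - ∫ y, y ∂μ : ℝ) * I))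
      * (Complex.exp (centredLogCharFun μ t)
        - Real.exp (-((∫ y, y ^ 2 ∂μ) * t ^ 2 / 2)))‖ ≤ K) :
    ‖∫ t in Icc (-π) π, Complex.exp (-(t * x * I))
        * (charFun (multiJumpPart μ) t - charFun (gaussianReal (∫ y, y ∂μ) (σ ^ 2)) t)‖
      ≤ K + Real.exp (-μ.real univ) * (1 + μ.real univ) * (2 * π) := by
  have hcont : Continuous fun t : ℝ => Complex.exp (-(t * (x - ∫ y, y ∂μ : ℝ) * I))
      * (Complex.exp (centredLogCharFun μ t) - Real.exp (-((∫ y, y ^ 2 ∂μ) * t ^ 2 / 2))) := by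
    fun_prop
  have hcont' : Continuous fun t : ℝ => Complex.exp (-(t * x * I))
      * (Real.exp (-μ.real univ) * (1 + charFun μ t)) := by fun_prop
  have hsplit : ∀ t : ℝ, Complex.exp (-(t * x * I))
        * (charFun (multiJumpPart μ) t - charFun (gaussianReal (∫ y, y ∂μ) (σ ^ 2)) t)
      = Complex.exp (-(t * (x - ∫ y, y ∂μ : ℝ) * I)) * (Complex.exp (centredLogCharFun μ t)
          - Real.exp (-((∫ y, y ^ 2 ∂μ) * t ^ 2 / 2)))
        - Complex.exp (-(t * x * I)) * (Real.exp (-μ.real univ) * (1 + charFun μ t)) := fun t => by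
    have hshift : Complex.exp (-(t * (x - ∫ y, y ∂μ : ℝ) * I))
        = Complex.exp (-(t * x * I)) * Complex.exp (t * (∫ y, y ∂μ : ℝ) * I) := by
      rw [← Complex.exp_add]
      push_cast
      ring_nf
    rw [charFun_multiJumpPart_eq_centred, charFun_gaussianReal_eq_mul, hshift, hvar, NNReal.coe_pow]
    ring
  have hsmall : ∀ t ∈ Icc (-π) π,
      ‖Complex.exp (-(t * x * I)) * (Real.exp (-μ.real univ) * (1 + charFun μ t))‖
        ≤ Real.exp (-μ.real univ) * (1 + μ.real univ) := fun t _ => by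
    rw [norm_mul, norm_cexp_neg_mul_mul_I, one_mul, norm_mul, Complex.norm_real,
      Real.norm_of_nonneg (Real.exp_pos _).le]
    gcongr
    exact (norm_add_le _ _).trans (by simpa using norm_charFun_le t)
  simp_rw [hsplit]
  rw [integral_sub hcont.integrableOn_Icc hcont'.integrableOn_Icc]
  refine (norm_sub_le _ _).trans (add_le_add hK ?_)
  refine (norm_setIntegral_le_of_norm_le_const measure_Icc_lt_top hsmall).trans_eq ?_
  rw [Real.volume_real_Icc_of_le (by linarith [Real.pi_pos])]
  ring
lemma abs_charFunDensity_multiJumpPart_sub_le {B : ℝ≥0} (hB : μ ≤ B • (volume : Measure ℝ))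
    (hσ : σ ≠ 0) (hvar : ∫ y, y ^ 2 ∂μ = σ ^ 2) {δ : ℝ} (hδ : δ ≤ μ.real univ)
    (hdecay : ∀ t, π ≤ |t| → (charFun μ t).re ≤ μ.real univ - δ) {x K : ℝ}
    (hK : ‖∫ t in Icc (-π) π, Complex.exp (-(t * (x - ∫ y, y ∂μ : ℝ) * I))
      * (Complex.exp (centredLogCharFun μ t)
        - Real.exp (-((∫ y, y ^ 2 ∂μ) * t ^ 2 / 2)))‖ ≤ K) :
    |charFunDensity (multiJumpPart μ) x - gaussianPDFReal (∫ y, y ∂μ) (σ ^ 2) x|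
      ≤ K + gaussMoment (1 / 2) 2 / σ ^ 3
        + Real.exp (-δ) * (2 * π * (1 + μ.real univ + B * μ.real univ)) := by
  have hR := integrable_charFun_multiJumpPart hB
  have hN := integrable_charFun_gaussianReal (∫ y, y ∂μ) (v := σ ^ 2) (by positivity)
  have htail : ∫ t in (Icc (-π) π)ᶜ,
        ‖charFun (multiJumpPart μ) t - charFun (gaussianReal (∫ y, y ∂μ) (σ ^ 2)) t‖
      ≤ Real.exp (-δ) * (2 * π * (B * μ.real univ)) + gaussMoment (1 / 2) 2 / σ ^ 3 :=
    calc _ ≤ ∫ t in (Icc (-π) π)ᶜ, (‖charFun (multiJumpPart μ) t‖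
            + ‖charFun (gaussianReal (∫ y, y ∂μ) (σ ^ 2)) t‖) :=
          integral_mono (hR.sub hN).norm.integrableOn (hR.norm.add hN.norm).integrableOn
            fun t => norm_sub_le _ _
      _ = _ := integral_add hR.norm.integrableOn hN.norm.integrableOn
      _ ≤ _ := add_le_add (setIntegral_compl_norm_charFun_multiJumpPart_le hB hδ hdecay)
          (setIntegral_compl_norm_charFun_gaussianReal_le _ hσ)
  have hatom : Real.exp (-μ.real univ) * (1 + μ.real univ) * (2 * π)
      ≤ Real.exp (-δ) * (1 + μ.real univ) * (2 * π) := by gcongr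
  rw [← charFunDensity_gaussianReal _ (by positivity)]
  refine (abs_charFunDensity_sub_le hR hN measurableSet_Icc
    (norm_setIntegral_charFun_sub_le hvar hK) htail).trans ?_
  linarith

lemma norm_setIntegral_cexp_centredLogCharFun_sub_le (hμ : ∀ᵐ x ∂μ, x ∈ Icc (0 : ℝ) 1)
    (hσ : σ ≠ 0) (hvar : ∫ y, y ^ 2 ∂μ = σ ^ 2) (x : ℝ) :
    ‖∫ t in Icc (-π) π, Complex.exp (-(t * x * I))
        * (Complex.exp (centredLogCharFun μ t) - Real.exp (-((∫ y, y ^ 2 ∂μ) * t ^ 2 / 2)))‖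
      ≤ Real.exp π * gaussMoment (2 / π ^ 2) 3 / σ ^ 2 := by
  have hσ' : (0 : ℝ) < σ := by positivity
  have hint := (integrable_abs_pow_mul_exp_scaled (b := 2 / π ^ 2) (by positivity) hσ' 3).const_mul
    (Real.exp π * σ ^ 2)
  calc _ ≤ ∫ t in Icc (-π) π, Real.exp π * σ ^ 2
          * (|t| ^ 3 * Real.exp (-(2 / π ^ 2 * (σ ^ 2 * t ^ 2)))) := by
        refine norm_integral_le_of_norm_le hint.integrableOn
          (ae_restrict_of_forall_mem measurableSet_Icc fun t ht => ?_)
        rw [norm_mul, norm_cexp_neg_mul_mul_I, one_mul]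
        refine (norm_cexp_centredLogCharFun_sub_le hμ (abs_le.2 ht)).trans_eq ?_
        rw [hvar]
        ring
    _ ≤ ∫ t, Real.exp π * σ ^ 2 * (|t| ^ 3 * Real.exp (-(2 / π ^ 2 * (σ ^ 2 * t ^ 2)))) :=
        setIntegral_le_integral hint (ae_of_all _ fun t => by positivity)
    _ = _ := by
        rw [integral_const_mul, integral_abs_pow_mul_exp_scaled _ hσ']
        field_simp
        ring

/-- The third cumulant enters through an odd integrand, which costs nothing at the mean. -/
lemma setIntegral_Icc_neg_cubic_mul_exp_eq_zero (c : ℂ) (V : ℝ) {r : ℝ} (hr : 0 ≤ r) :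
    ∫ t in Icc (-r) r, (t * I) ^ 3 / 6 * c * (Real.exp (-(V * t ^ 2 / 2)) : ℂ) = 0 :=
  setIntegral_Icc_neg_eq_zero_of_odd (f := fun t : ℝ => (t * I) ^ 3 / 6 * c
    * (Real.exp (-(V * t ^ 2 / 2)) : ℂ)) (fun t => by push_cast; ring_nf) hr

lemma norm_setIntegral_cexp_centredLogCharFun_sub_le_at_mean
    (hμ : ∀ᵐ x ∂μ, x ∈ Icc (0 : ℝ) 1) (hσ : σ ≠ 0) (hvar : ∫ y, y ^ 2 ∂μ = σ ^ 2) :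
    ‖∫ t in Icc (-π) π,
        (Complex.exp (centredLogCharFun μ t) - Real.exp (-((∫ y, y ^ 2 ∂μ) * t ^ 2 / 2)))‖
      ≤ (Real.exp π ^ 2 * gaussMoment (2 / π ^ 2) 6 + Real.exp π * gaussMoment (2 / π ^ 2) 4)
        / σ ^ 3 := by
  have hσ' : (0 : ℝ) < σ := by positivity
  have hint6 := (integrable_abs_pow_mul_exp_scaled (b := 2 / π ^ 2) (by positivity) hσ' 6).const_mul
    (Real.exp π ^ 2 * σ ^ 4)
  have hint4 := (integrable_abs_pow_mul_exp_scaled (b := 2 / π ^ 2) (by positivity) hσ' 4).const_mul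
    (Real.exp π * σ ^ 2)
  have hcont : Continuous fun t : ℝ =>
      Complex.exp (centredLogCharFun μ t) - Real.exp (-((∫ y, y ^ 2 ∂μ) * t ^ 2 / 2)) :=
    continuous_centredLogCharFun.cexp.sub (by fun_prop)
  have hcont_cubic : Continuous fun t : ℝ => (t * I) ^ 3 / 6 * ((∫ x, x ^ 3 ∂μ : ℝ) : ℂ)
      * Real.exp (-((∫ y, y ^ 2 ∂μ) * t ^ 2 / 2)) := by fun_prop
  calc _ = ‖∫ t in Icc (-π) π,
          (Complex.exp (centredLogCharFun μ t) - Real.exp (-((∫ y, y ^ 2 ∂μ) * t ^ 2 / 2))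
            - (t * I) ^ 3 / 6 * (∫ x, x ^ 3 ∂μ : ℝ)
              * Real.exp (-((∫ y, y ^ 2 ∂μ) * t ^ 2 / 2)))‖ := by
        rw [integral_sub hcont.integrableOn_Icc hcont_cubic.integrableOn_Icc,
          setIntegral_Icc_neg_cubic_mul_exp_eq_zero _ _ Real.pi_pos.le, sub_zero]
    _ ≤ ∫ t in Icc (-π) π,
          (Real.exp π ^ 2 * σ ^ 4 * (|t| ^ 6 * Real.exp (-(2 / π ^ 2 * (σ ^ 2 * t ^ 2))))
            + Real.exp π * σ ^ 2 * (|t| ^ 4 * Real.exp (-(2 / π ^ 2 * (σ ^ 2 * t ^ 2))))) := by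
        refine norm_integral_le_of_norm_le (hint6.add hint4).integrableOn
          (ae_restrict_of_forall_mem measurableSet_Icc fun t ht => ?_)
        refine (norm_cexp_centredLogCharFun_sub_sub_le hμ (abs_le.2 ht)).trans_eq ?_
        rw [hvar, Even.pow_abs (n := 4) (by decide)]
        ring
    _ ≤ ∫ t, (Real.exp π ^ 2 * σ ^ 4 * (|t| ^ 6 * Real.exp (-(2 / π ^ 2 * (σ ^ 2 * t ^ 2))))
            + Real.exp π * σ ^ 2 * (|t| ^ 4 * Real.exp (-(2 / π ^ 2 * (σ ^ 2 * t ^ 2))))) :=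
        setIntegral_le_integral (hint6.add hint4) (ae_of_all _ fun t => by positivity)
    _ = _ := by
        rw [integral_add hint6 hint4, integral_const_mul, integral_const_mul,
          integral_abs_pow_mul_exp_scaled _ hσ', integral_abs_pow_mul_exp_scaled _ hσ']
        field_simp
        ring

lemma withDensity_ofReal_le_smul_volume {h : ℝ → ℝ} {B : ℝ≥0} (hB : ∀ x, h x ≤ B) :
    volume.withDensity (fun x => ENNReal.ofReal (h x)) ≤ B • (volume : Measure ℝ) :=
  calc _ ≤ volume.withDensity fun _ => (B : ℝ≥0∞) :=
        withDensity_mono (ae_of_all _ fun x => ENNReal.ofReal_le_of_le_toReal (hB x))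
    _ = _ := withDensity_const _

lemma compoundPoissonDensity_sub_eq {h : ℝ → ℝ}
    (hμ : μ = volume.withDensity fun x => ENNReal.ofReal (h x)) (x c : ℝ) :
    compoundPoissonDensity h x - c
      = Real.exp (-μ.real univ) * h x + (charFunDensity (multiJumpPart μ) x - c) := by
  subst hμ
  rw [compoundPoissonDensity, add_sub_assoc]

lemma abs_compoundPoissonDensity_sub_gaussianPDFReal_le_of {h : ℝ → ℝ} {B : ℝ≥0}
    (hμ : μ = volume.withDensity fun x => ENNReal.ofReal (h x)) (h0 : ∀ x, 0 ≤ h x)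
    (hB : ∀ x, h x ≤ B)
    (hσ : σ ≠ 0) (hvar : ∫ y, y ^ 2 ∂μ = σ ^ 2) {δ : ℝ} (hδ : δ ≤ μ.real univ)
    (hdecay : ∀ t, π ≤ |t| → (charFun μ t).re ≤ μ.real univ - δ) {x K : ℝ}
    (hK : ‖∫ t in Icc (-π) π, Complex.exp (-(t * (x - ∫ y, y ∂μ : ℝ) * I))
      * (Complex.exp (centredLogCharFun μ t)
        - Real.exp (-((∫ y, y ^ 2 ∂μ) * t ^ 2 / 2)))‖ ≤ K) :
    |compoundPoissonDensity h x - gaussianPDFReal (∫ y, y ∂μ) (σ ^ 2) x|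
      ≤ K + gaussMoment (1 / 2) 2 / σ ^ 3
        + Real.exp (-δ) * (2 * π * ((1 + B) * (1 + μ.real univ))) := by
  have hμB : μ ≤ B • (volume : Measure ℝ) := hμ ▸ withDensity_ofReal_le_smul_volume hB
  have hjump : |Real.exp (-μ.real univ) * h x| ≤ Real.exp (-δ) * (2 * π * B) := by
    rw [abs_of_nonneg (mul_nonneg (Real.exp_pos _).le (h0 x))]
    have hB' : h x ≤ 2 * π * B :=
      (hB x).trans (le_mul_of_one_le_left B.2 (by linarith [Real.pi_gt_three]))
    exact mul_le_mul (Real.exp_le_exp.2 (by linarith)) hB' (h0 x) (Real.exp_pos _).le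
  rw [compoundPoissonDensity_sub_eq hμ]
  refine (abs_add_le _ _).trans ?_
  linarith [abs_charFunDensity_multiJumpPart_sub_le hμB hσ hvar hδ hdecay hK]

theorem abs_compoundPoissonDensity_sub_gaussianPDFReal_le {h : ℝ → ℝ} {B : ℝ≥0}
    (hμ : μ = volume.withDensity fun x => ENNReal.ofReal (h x)) (h0 : ∀ x, 0 ≤ h x)
    (hB : ∀ x, h x ≤ B) (hsupp : ∀ᵐ x ∂μ, x ∈ Icc (0 : ℝ) 1) (hσ : σ ≠ 0)
    (hvar : ∫ y, y ^ 2 ∂μ = σ ^ 2) {δ : ℝ} (hδ : δ ≤ μ.real univ)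
    (hdecay : ∀ t, π ≤ |t| → (charFun μ t).re ≤ μ.real univ - δ) (x : ℝ) :
    |compoundPoissonDensity h x - gaussianPDFReal (∫ y, y ∂μ) (σ ^ 2) x|
      ≤ Real.exp π * gaussMoment (2 / π ^ 2) 3 / σ ^ 2 + gaussMoment (1 / 2) 2 / σ ^ 3
        + Real.exp (-δ) * (2 * π * ((1 + B) * (1 + μ.real univ))) :=
  abs_compoundPoissonDensity_sub_gaussianPDFReal_le_of hμ h0 hB hσ hvar hδ hdecay
    (norm_setIntegral_cexp_centredLogCharFun_sub_le hsupp hσ hvar _)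

theorem abs_compoundPoissonDensity_sub_gaussianPDFReal_le_at_mean {h : ℝ → ℝ} {B : ℝ≥0}
    (hμ : μ = volume.withDensity fun x => ENNReal.ofReal (h x)) (h0 : ∀ x, 0 ≤ h x)
    (hB : ∀ x, h x ≤ B) (hsupp : ∀ᵐ x ∂μ, x ∈ Icc (0 : ℝ) 1) (hσ : σ ≠ 0)
    (hvar : ∫ y, y ^ 2 ∂μ = σ ^ 2) {δ : ℝ} (hδ : δ ≤ μ.real univ)
    (hdecay : ∀ t, π ≤ |t| → (charFun μ t).re ≤ μ.real univ - δ) :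
    |compoundPoissonDensity h (∫ y, y ∂μ)
        - gaussianPDFReal (∫ y, y ∂μ) (σ ^ 2) (∫ y, y ∂μ)|
      ≤ (Real.exp π ^ 2 * gaussMoment (2 / π ^ 2) 6 + Real.exp π * gaussMoment (2 / π ^ 2) 4)
          / σ ^ 3 + gaussMoment (1 / 2) 2 / σ ^ 3
        + Real.exp (-δ) * (2 * π * ((1 + B) * (1 + μ.real univ))) :=
  abs_compoundPoissonDensity_sub_gaussianPDFReal_le_of hμ h0 hB hσ hvar hδ hdecay
    (by simpa using norm_setIntegral_cexp_centredLogCharFun_sub_le_at_mean hsupp hσ hvar)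

end LocalLimit

section Oscillation

lemma abs_sin_le_sub_cube {v : ℝ} (h0 : 0 ≤ v) (h1 : v ≤ 1) : |Real.sin v| ≤ v - v ^ 3 / 10 := by
  have hbound := (abs_le.1 (Real.sin_bound (abs_of_nonneg h0 ▸ h1))).2
  rw [abs_of_nonneg h0] at hbound
  rw [abs_of_nonneg (Real.sin_nonneg_of_nonneg_of_le_pi h0 (by linarith [Real.pi_gt_three]))]
  have hpow : v ^ 5 ≤ v ^ 3 := pow_le_pow_of_le_one h0 h1 (by norm_num)
  linarith [pow_nonneg h0 3]

lemma abs_sin_le_mul_of_one_le {v : ℝ} (hv : 1 ≤ v) : |Real.sin v| ≤ 19 / 20 * v := by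
  rcases le_total v 2 with h2 | h2
  · have hone := abs_sin_le_sub_cube zero_le_one le_rfl
    have hlipschitz := Real.abs_sin_sub_sin_le v 1
    rw [abs_of_nonneg (sub_nonneg.2 hv)] at hlipschitz
    linarith [abs_sub_abs_le_abs_sub (Real.sin v) (Real.sin 1)]
  · linarith [Real.abs_sin_le_one v]

lemma abs_sin_le_mul_one_sub {h v : ℝ} (h0 : 0 < h) (hh : h ≤ 1 / 2) (hv : π * h / 2 ≤ v) :
    |Real.sin v| ≤ v * (1 - h ^ 2 / 5) := by
  have hhv : 3 * h / 2 ≤ v := by nlinarith [Real.pi_gt_three]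
  have hv0 : 0 < v := by linarith
  rcases le_total v 1 with h1 | h1
  · have hsq : h ^ 2 ≤ 4 / 9 * v ^ 2 := by nlinarith
    calc |Real.sin v| ≤ v - v ^ 3 / 10 := abs_sin_le_sub_cube hv0.le h1
      _ ≤ v * (1 - 4 / 9 * v ^ 2 / 5) := by linarith [pow_pos hv0 3]
      _ ≤ v * (1 - h ^ 2 / 5) := by gcongr
  · calc |Real.sin v| ≤ 19 / 20 * v := abs_sin_le_mul_of_one_le h1
      _ = v * (1 - (1 / 2) ^ 2 / 5) := by ring
      _ ≤ v * (1 - h ^ 2 / 5) := by gcongr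

lemma le_setIntegral_one_sub_cos {h t : ℝ} (h0 : 0 < h) (hh : h ≤ 1 / 2) (ht : π ≤ |t|) :
    h ^ 3 / 5 ≤ ∫ x in Icc (1 - h) 1, (1 - Real.cos (t * x)) := by
  have hcos : ∀ x, Real.cos (t * x) = Real.cos (|t| * x) := fun x => by
    rcases abs_choice t with h | h <;> simp only [h, neg_mul, Real.cos_neg]
  simp only [hcos]
  have hu : 0 < |t| := Real.pi_pos.trans_le ht
  generalize |t| = u at ht hu
  have hsin : Real.sin (u * h / 2) * Real.cos (u * (1 - h / 2)) ≤ u * h / 2 * (1 - h ^ 2 / 5) :=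
    calc _ ≤ |Real.sin (u * h / 2)| * |Real.cos (u * (1 - h / 2))| := by
          rw [← abs_mul]
          exact le_abs_self _
      _ ≤ |Real.sin (u * h / 2)| := mul_le_of_le_one_right (abs_nonneg _) (Real.abs_cos_le_one _)
      _ ≤ _ := abs_sin_le_mul_one_sub h0 hh (by gcongr)
  calc h ^ 3 / 5 = h - u⁻¹ * (2 * (u * h / 2 * (1 - h ^ 2 / 5))) := by field_simp; ring
    _ ≤ h - u⁻¹ * (2 * (Real.sin (u * h / 2) * Real.cos (u * (1 - h / 2)))) := by gcongr
    _ = ∫ x in Icc (1 - h) 1, (1 - Real.cos (u * x)) := by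
      rw [integral_Icc_eq_integral_Ioc, ← intervalIntegral.integral_of_le (by linarith),
        intervalIntegral.integral_sub (by simp) (Continuous.intervalIntegrable (by fun_prop) _ _),
        intervalIntegral.integral_const, intervalIntegral.integral_comp_mul_left _ hu.ne',
        integral_cos, Real.sin_sub_sin, smul_eq_mul, smul_eq_mul]
      ring_nf

end Oscillation

section TiltedJump

/-- The jump measure `exp (β x) g(x) dx` of the `β`-tilt of the infinitely divisible law with Lévy
density `g`. -/
noncomputable def tiltedJump (g : ℝ → ℝ) (β : ℝ) : Measure ℝ :=
  volume.withDensity fun x => ENNReal.ofReal (Real.exp (β * x) * g x)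

/-- `g` is a Lévy density carried by `[0, 1]`, bounded by `M` and at least `ε` close to `1`. The
normalisation `1 ≤ M` costs nothing and makes the powers of `M` in the error terms monotone. -/
structure LevyDensityBounds (g : ℝ → ℝ) (M ε : ℝ) : Prop where
  measurable : Measurable g
  nonneg : ∀ x, 0 ≤ g x
  le : ∀ x, g x ≤ M
  eq_zero : ∀ x ∉ Icc (0 : ℝ) 1, g x = 0
  le_of_one_sub_le : ∀ x ∈ Icc (0 : ℝ) 1, 1 - ε ≤ x → ε ≤ g x
  one_le : 1 ≤ M
  pos : 0 < ε

lemma integrable_indicator_exp_mul (β M : ℝ) :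
    Integrable ((Icc (0 : ℝ) 1).indicator fun x => Real.exp (β * x) * M) := by
  rw [integrable_indicator_iff measurableSet_Icc]
  exact (Continuous.continuousOn (by fun_prop)).integrableOn_compact isCompact_Icc

namespace LevyDensityBounds

variable {g : ℝ → ℝ} {M ε : ℝ}

lemma exp_mul_nonneg (hg : LevyDensityBounds g M ε) (β x : ℝ) : 0 ≤ Real.exp (β * x) * g x :=
  mul_nonneg (Real.exp_pos _).le (hg.nonneg x)

lemma measurable_exp_mul (hg : LevyDensityBounds g M ε) (β : ℝ) :
    Measurable fun x => Real.exp (β * x) * g x := by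
  have := hg.measurable
  fun_prop

lemma exp_mul_le_indicator (hg : LevyDensityBounds g M ε) (β x : ℝ) :
    Real.exp (β * x) * g x ≤ (Icc (0 : ℝ) 1).indicator (fun x => Real.exp (β * x) * M) x := by
  by_cases hx : x ∈ Icc (0 : ℝ) 1
  · rw [indicator_of_mem hx]
    gcongr
    exact hg.le x
  · rw [indicator_of_notMem hx, hg.eq_zero x hx, mul_zero]

lemma exp_mul_le (hg : LevyDensityBounds g M ε) (β x : ℝ) :
    Real.exp (β * x) * g x ≤ (M * Real.exp |β|).toNNReal := by
  have hM := hg.one_le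
  rw [Real.coe_toNNReal _ (by positivity), mul_comm M]
  refine (hg.exp_mul_le_indicator β x).trans
    (indicator_le' (g := fun _ => Real.exp |β| * M) (fun y hy => ?_) (fun y _ => ?_) x)
  · gcongr
    calc β * y ≤ |β| * 1 := mul_le_mul (le_abs_self β) hy.2 hy.1 (abs_nonneg β)
      _ = |β| := mul_one _
  · positivity

lemma tiltedJump_le (hg : LevyDensityBounds g M ε) (β : ℝ) :
    tiltedJump g β ≤ (M * Real.exp |β|).toNNReal • (volume : Measure ℝ) :=
  withDensity_ofReal_le_smul_volume (hg.exp_mul_le β)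

lemma ae_mem_Icc (hg : LevyDensityBounds g M ε) (β : ℝ) :
    ∀ᵐ x ∂(tiltedJump g β), x ∈ Icc (0 : ℝ) 1 := by
  rw [tiltedJump, ae_withDensity_iff (hg.measurable_exp_mul β).ennreal_ofReal]
  refine ae_of_all _ fun x hx => ?_
  by_contra hcon
  simp [hg.eq_zero x hcon] at hx

lemma integrable_exp_mul (hg : LevyDensityBounds g M ε) (β : ℝ) :
    Integrable fun x => Real.exp (β * x) * g x :=
  (integrable_indicator_exp_mul β M).mono' (hg.measurable_exp_mul β).aestronglyMeasurable
    (ae_of_all _ fun x => by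
      rw [Real.norm_of_nonneg (hg.exp_mul_nonneg β x)]
      exact hg.exp_mul_le_indicator β x)

lemma isFiniteMeasure_tiltedJump (hg : LevyDensityBounds g M ε) (β : ℝ) :
    IsFiniteMeasure (tiltedJump g β) :=
  isFiniteMeasure_withDensity_ofReal (hg.integrable_exp_mul β).2

lemma expTilt_tiltedJump_zero (hg : LevyDensityBounds g M ε) (β : ℝ) :
    expTilt (tiltedJump g 0) β = tiltedJump g β := by
  have := hg.measurable
  rw [expTilt, tiltedJump, ← withDensity_mul _ (by fun_prop) (by fun_prop), tiltedJump]
  congr 1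
  funext x
  rw [Pi.mul_apply, zero_mul, Real.exp_zero, one_mul, ← ENNReal.ofReal_mul (hg.nonneg x), mul_comm]

lemma integrableExpSet_tiltedJump_zero (hg : LevyDensityBounds g M ε) :
    integrableExpSet id (tiltedJump g 0) = univ := by
  have := hg.isFiniteMeasure_tiltedJump 0
  exact eq_univ_of_forall fun θ => integrable_of_ae_mem_Icc (hg.ae_mem_Icc 0)
    (f := fun x => Real.exp (θ * id x)) (by simp only [id]; fun_prop)

lemma measureReal_tiltedJump_univ (hg : LevyDensityBounds g M ε) (β : ℝ) :
    (tiltedJump g β).real univ = ∫ x, Real.exp (β * x) * g x := by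
  rw [measureReal_def, tiltedJump, withDensity_apply _ MeasurableSet.univ, Measure.restrict_univ,
    integral_eq_lintegral_of_nonneg_ae (ae_of_all _ (hg.exp_mul_nonneg β))
      (hg.measurable_exp_mul β).aestronglyMeasurable]

lemma measureReal_tiltedJump_univ_le (hg : LevyDensityBounds g M ε) {β : ℝ} (hβ : 0 < β) :
    (tiltedJump g β).real univ ≤ M * (Real.exp β / β) :=
  have hM := zero_le_one.trans hg.one_le
  calc (tiltedJump g β).real univ
      ≤ ∫ x, (Icc (0 : ℝ) 1).indicator (fun x => Real.exp (β * x) * M) x := by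
        rw [hg.measureReal_tiltedJump_univ]
        exact integral_mono (hg.integrable_exp_mul β) (integrable_indicator_exp_mul β M)
          (hg.exp_mul_le_indicator β)
    _ = M * ((Real.exp β - 1) / β) := by
        rw [integral_indicator measurableSet_Icc, integral_Icc_eq_integral_Ioc,
          ← intervalIntegral.integral_of_le zero_le_one, intervalIntegral.integral_mul_const,
          intervalIntegral.integral_comp_mul_left _ hβ.ne', integral_exp, smul_eq_mul, mul_zero,
          mul_one, Real.exp_zero, mul_comm, inv_mul_eq_div]
    _ ≤ M * (Real.exp β / β) := by
        gcongr
        linarith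

lemma smul_volume_restrict_le_tiltedJump (hg : LevyDensityBounds g M ε) {β h : ℝ} (hh1 : h ≤ 1)
    (hhε : h ≤ ε) {c : ℝ≥0} (hc : ∀ x ∈ Icc (1 - h) 1, c ≤ Real.exp (β * x) * ε) :
    c • volume.restrict (Icc (1 - h) 1) ≤ tiltedJump g β := by
  have hdensity : c • volume.restrict (Icc (1 - h) 1)
      = volume.withDensity ((Icc (1 - h) 1).indicator fun _ => (c : ℝ≥0∞)) := by
    rw [withDensity_indicator measurableSet_Icc, withDensity_const]
    rfl
  rw [hdensity]
  refine withDensity_mono (ae_of_all _ (indicator_le' (fun x hx => ?_) fun x _ => zero_le))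
  rw [← ENNReal.ofReal_coe_nnreal]
  refine ENNReal.ofReal_le_ofReal ((hc x hx).trans ?_)
  gcongr
  exact hg.le_of_one_sub_le x ⟨by linarith [hx.1], hx.2⟩ (by linarith [hx.1])

lemma mul_setIntegral_le_integral_tiltedJump (hg : LevyDensityBounds g M ε) {β h : ℝ} (hh1 : h ≤ 1)
    (hhε : h ≤ ε) {c : ℝ≥0} (hc : ∀ x ∈ Icc (1 - h) 1, c ≤ Real.exp (β * x) * ε) {f : ℝ → ℝ}
    (hf : Continuous f) (hf0 : ∀ x, 0 ≤ f x) :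
    c * ∫ x in Icc (1 - h) 1, f x ≤ ∫ x, f x ∂(tiltedJump g β) := by
  have := hg.isFiniteMeasure_tiltedJump β
  calc c * ∫ x in Icc (1 - h) 1, f x
      = ∫ x, f x ∂(c • volume.restrict (Icc (1 - h) 1)) := by
        rw [integral_smul_nnreal_measure, NNReal.smul_def, smul_eq_mul]
    _ ≤ _ := integral_mono_measure (hg.smul_volume_restrict_le_tiltedJump hh1 hhε hc)
        (ae_of_all _ hf0) (integrable_of_ae_mem_Icc (hg.ae_mem_Icc β) hf)

lemma le_integral_sq_tiltedJump (hg : LevyDensityBounds g M ε) {β h : ℝ} (hh0 : 0 < h)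
    (hh : h ≤ 1 / 2) (hhε : h ≤ ε) {c : ℝ≥0} (hc : ∀ x ∈ Icc (1 - h) 1, c ≤ Real.exp (β * x) * ε) :
    c * (h / 4) ≤ ∫ x, x ^ 2 ∂(tiltedJump g β) := by
  refine le_trans ?_ (hg.mul_setIntegral_le_integral_tiltedJump (by linarith) hhε hc
    (continuous_pow 2) sq_nonneg)
  gcongr
  calc h / 4 = ∫ x in Icc (1 - h) 1, (1 / 4 : ℝ) := by
        rw [setIntegral_const, measureReal_def, Real.volume_Icc,
          ENNReal.toReal_ofReal (by linarith), smul_eq_mul]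
        ring
    _ ≤ ∫ x in Icc (1 - h) 1, x ^ 2 :=
        setIntegral_mono_on (integrable_const _)
          ((continuous_pow 2).continuousOn.integrableOn_compact isCompact_Icc)
          measurableSet_Icc fun x hx => by nlinarith [hx.1]

lemma re_charFun_tiltedJump_le (hg : LevyDensityBounds g M ε) {β h : ℝ} (hh0 : 0 < h)
    (hh : h ≤ 1 / 2) (hhε : h ≤ ε) {c : ℝ≥0} (hc : ∀ x ∈ Icc (1 - h) 1, c ≤ Real.exp (β * x) * ε)
    {t : ℝ} (ht : π ≤ |t|) :
    (charFun (tiltedJump g β) t).re ≤ (tiltedJump g β).real univ - c * (h ^ 3 / 5) := by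
  have := hg.isFiniteMeasure_tiltedJump β
  suffices c * (h ^ 3 / 5) ≤ (tiltedJump g β).real univ - (charFun (tiltedJump g β) t).re by
    linarith
  calc c * (h ^ 3 / 5) ≤ c * ∫ x in Icc (1 - h) 1, (1 - Real.cos (t * x)) := by
        gcongr
        exact le_setIntegral_one_sub_cos hh0 hh ht
    _ ≤ ∫ x, (1 - Real.cos (t * x)) ∂(tiltedJump g β) :=
        hg.mul_setIntegral_le_integral_tiltedJump (by linarith) hhε hc (by fun_prop)
          fun x => sub_nonneg.2 (Real.cos_le_one _)
    _ = _ := by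
        rw [integral_sub (integrable_const _)
          (integrable_of_ae_mem_Icc (hg.ae_mem_Icc β) (by fun_prop)), ← re_charFun, integral_const,
          smul_eq_mul, mul_one]

end LevyDensityBounds

end TiltedJump

section Asymptotics

lemma exp_sub_one_mul_le {ε β : ℝ} (hβ : 0 < β) (hε : 0 ≤ ε) :
    ∀ x ∈ Icc (1 - β⁻¹) 1, Real.exp (β - 1) * ε ≤ Real.exp (β * x) * ε := fun x hx => by
  gcongr
  calc β - 1 = β * (1 - β⁻¹) := by field_simp
    _ ≤ β * x := by gcongr; exact hx.1

lemma eventually_mul_le_exp_sub_one_mul_inv_pow {ε : ℝ} (hε : 0 < ε) (K : ℝ) (n : ℕ) :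
    ∀ᶠ β : ℝ in atTop, K * β ≤ Real.exp (β - 1) * ε * β⁻¹ ^ n := by
  filter_upwards [(Real.tendsto_exp_div_pow_atTop (n + 1)).eventually_ge_atTop
    (K * (Real.exp 1 / ε)), eventually_gt_atTop 0] with β hK hβ
  rw [le_div_iff₀ (by positivity)] at hK
  calc K * β = K * (Real.exp 1 / ε) * β ^ (n + 1) / (Real.exp 1 * β ^ n) * ε := by
        field_simp
        ring
    _ ≤ Real.exp β / (Real.exp 1 * β ^ n) * ε := by gcongr
    _ = Real.exp (β - 1) * ε * β⁻¹ ^ n := by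
        rw [Real.exp_sub, inv_pow]
        field_simp

lemma div_le_div_mul_one_div {A c E s : ℝ} (hA : 0 ≤ A) (hc : 0 < c) (hE : 0 < E) (hs : c * E ≤ s) :
    A / s ≤ A / c * (1 / E) := by
  rw [div_mul_div_comm, mul_one]
  gcongr

/-- The mean `E_β` of the tilted law, as the first moment of its jump measure. -/
noncomputable def jumpMean (g : ℝ → ℝ) (β : ℝ) : ℝ := ∫ x, x ∂(tiltedJump g β)

/-- The standard deviation `σ_β` of the tilted law: its variance is the second moment of its jump
measure. -/
noncomputable def jumpSD (g : ℝ → ℝ) (β : ℝ) : ℝ≥0 :=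
  (Real.sqrt (∫ x, x ^ 2 ∂(tiltedJump g β))).toNNReal

/-- The density, off the atom, of the standardized tilted law. -/
noncomputable def stdDensity (g : ℝ → ℝ) (β y : ℝ) : ℝ :=
  jumpSD g β * compoundPoissonDensity (fun x => Real.exp (β * x) * g x)
    (jumpMean g β + jumpSD g β * y)

lemma mul_gaussianPDFReal_affine {σ : ℝ≥0} (hσ : σ ≠ 0) (m y : ℝ) :
    σ * gaussianPDFReal m (σ ^ 2) (m + σ * y)
      = 1 / Real.sqrt (2 * π) * Real.exp (-y ^ 2 / 2) := by
  have hσ' : (σ : ℝ) ≠ 0 := NNReal.coe_ne_zero.2 hσ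
  rw [gaussianPDFReal, NNReal.coe_pow, Real.sqrt_mul (by positivity),
    Real.sqrt_sq σ.coe_nonneg, add_sub_cancel_left]
  field_simp

lemma coe_jumpSD (g : ℝ → ℝ) (β : ℝ) :
    (jumpSD g β : ℝ) = Real.sqrt (∫ x, x ^ 2 ∂(tiltedJump g β)) :=
  Real.coe_toNNReal _ (Real.sqrt_nonneg _)

lemma jumpSD_sq (g : ℝ → ℝ) (β : ℝ) : (jumpSD g β : ℝ) ^ 2 = ∫ x, x ^ 2 ∂(tiltedJump g β) := by
  rw [coe_jumpSD, Real.sq_sqrt (integral_nonneg fun _ => sq_nonneg _)]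

namespace LevyDensityBounds

variable {g : ℝ → ℝ} {M ε : ℝ}

lemma jumpSD_pos (hg : LevyDensityBounds g M ε) (β : ℝ) : 0 < jumpSD g β := by
  have hε := hg.pos
  have hmem : ∀ x ∈ Icc (1 - min ε (1 / 2)) 1, Real.exp (-|β|) * ε ≤ Real.exp (β * x) * ε := by
    intro x hx
    have hx0 : 0 ≤ x := by linarith [hx.1, min_le_right ε (1 / 2)]
    gcongr
    calc -|β| ≤ -|β| * x := by nlinarith [hx.2, abs_nonneg β]
      _ ≤ β * x := by gcongr; exact neg_abs_le β
  have hpos : (0 : ℝ) < jumpSD g β ^ 2 := by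
    rw [jumpSD_sq]
    have hmin : 0 < min ε (1 / 2) := by positivity
    exact lt_of_lt_of_le (mul_pos (mul_pos (Real.exp_pos _) hε) (div_pos hmin four_pos))
      (hg.le_integral_sq_tiltedJump (c := ⟨Real.exp (-|β|) * ε, by positivity⟩) hmin
        (min_le_right _ _) (min_le_left _ _) hmem)
  exact pos_iff_ne_zero.2 fun h => by simp [h] at hpos

lemma jumpSD_sq_le_jumpMean (hg : LevyDensityBounds g M ε) (β : ℝ) :
    (jumpSD g β : ℝ) ^ 2 ≤ jumpMean g β := by
  have := hg.isFiniteMeasure_tiltedJump β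
  rw [jumpSD_sq, jumpMean]
  simpa using integral_pow_antitone (hg.ae_mem_Icc β) one_le_two

lemma jumpMean_le_measureReal_univ (hg : LevyDensityBounds g M ε) (β : ℝ) :
    jumpMean g β ≤ (tiltedJump g β).real univ := by
  have := hg.isFiniteMeasure_tiltedJump β
  simpa [jumpMean] using integral_pow_antitone (hg.ae_mem_Icc β) zero_le_one

lemma jumpMean_pos (hg : LevyDensityBounds g M ε) (β : ℝ) : 0 < jumpMean g β :=
  lt_of_lt_of_le (pow_pos (hg.jumpSD_pos β) 2) (hg.jumpSD_sq_le_jumpMean β)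

lemma le_jumpSD_sq (hg : LevyDensityBounds g M ε) {β : ℝ} (h2 : 2 ≤ β) (hβε : ε⁻¹ ≤ β) :
    Real.exp (β - 1) * ε * (β⁻¹ / 4) ≤ jumpSD g β ^ 2 := by
  have hε := hg.pos
  have hβ : 0 < β := by linarith
  rw [jumpSD_sq]
  exact hg.le_integral_sq_tiltedJump (c := ⟨Real.exp (β - 1) * ε, by positivity⟩)
    (inv_pos.2 hβ) (by rw [one_div]; gcongr) (inv_le_of_inv_le₀ hε hβε)
    (exp_sub_one_mul_le hβ hε.le)

lemma re_charFun_tiltedJump_le_sub (hg : LevyDensityBounds g M ε) {β : ℝ} (h2 : 2 ≤ β)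
    (hβε : ε⁻¹ ≤ β) {t : ℝ} (ht : π ≤ |t|) :
    (charFun (tiltedJump g β) t).re
      ≤ (tiltedJump g β).real univ - Real.exp (β - 1) * ε * (β⁻¹ ^ 3 / 5) := by
  have hε := hg.pos
  have hβ : 0 < β := by linarith
  exact hg.re_charFun_tiltedJump_le (c := ⟨Real.exp (β - 1) * ε, by positivity⟩)
    (inv_pos.2 hβ) (by rw [one_div]; gcongr) (inv_le_of_inv_le₀ hε hβε)
    (exp_sub_one_mul_le hβ hε.le) ht

lemma eventually_mul_le_jumpSD_sq (hg : LevyDensityBounds g M ε) (K : ℝ) :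
    ∀ᶠ β : ℝ in atTop, K * β ≤ (jumpSD g β : ℝ) ^ 2 := by
  filter_upwards [eventually_mul_le_exp_sub_one_mul_inv_pow hg.pos (4 * K) 1,
    eventually_ge_atTop 2, eventually_ge_atTop ε⁻¹] with β hK h2 hβε
  linarith [hg.le_jumpSD_sq h2 hβε]

theorem tendsto_jumpMean (hg : LevyDensityBounds g M ε) : Tendsto (jumpMean g) atTop atTop :=
  tendsto_atTop_mono' _ ((hg.eventually_mul_le_jumpSD_sq 1).mono fun β h =>
    (one_mul β ▸ h).trans (hg.jumpSD_sq_le_jumpMean β)) tendsto_id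

lemma eventually_mul_jumpMean_le_jumpSD_sq (hg : LevyDensityBounds g M ε) :
    ∀ᶠ β : ℝ in atTop, ε / (4 * Real.exp 1 * M) * jumpMean g β ≤ jumpSD g β ^ 2 := by
  have hε := hg.pos
  have hM := hg.one_le
  filter_upwards [eventually_ge_atTop 2, eventually_ge_atTop ε⁻¹] with β h2 hβε
  have hβ : 0 < β := by linarith
  calc ε / (4 * Real.exp 1 * M) * jumpMean g β
      ≤ ε / (4 * Real.exp 1 * M) * (M * (Real.exp β / β)) := by
        gcongr
        exact (hg.jumpMean_le_measureReal_univ β).trans (hg.measureReal_tiltedJump_univ_le hβ)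
    _ = Real.exp (β - 1) * ε * (β⁻¹ / 4) := by
        rw [Real.exp_sub]
        field_simp
    _ ≤ jumpSD g β ^ 2 := hg.le_jumpSD_sq h2 hβε

-- The rate `4 β` is chosen to beat the fourth power of the mass `≤ M * exp β` in the error terms.
lemma eventually_re_charFun_tiltedJump_le (hg : LevyDensityBounds g M ε) :
    ∀ᶠ β : ℝ in atTop, 4 * β ≤ (tiltedJump g β).real univ ∧
      ∀ t, π ≤ |t| → (charFun (tiltedJump g β) t).re ≤ (tiltedJump g β).real univ - 4 * β := by
  filter_upwards [hg.eventually_mul_le_jumpSD_sq 4, eventually_ge_atTop 2,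
    eventually_mul_le_exp_sub_one_mul_inv_pow hg.pos 20 3, eventually_ge_atTop ε⁻¹]
    with β hsd h2 hdecay hβε
  refine ⟨hsd.trans ((hg.jumpSD_sq_le_jumpMean β).trans (hg.jumpMean_le_measureReal_univ β)),
    fun t ht => ?_⟩
  linarith [hg.re_charFun_tiltedJump_le_sub h2 hβε ht]

lemma jumpSD_mul_exp_neg_mul_le (hg : LevyDensityBounds g M ε) {β : ℝ} (hβ : 1 ≤ β) :
    jumpSD g β * (Real.exp (-(4 * β)) * (2 * π * ((1 + (M * Real.exp |β|).toNNReal)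
      * (1 + (tiltedJump g β).real univ)))) ≤ 8 * π * M ^ 4 / jumpMean g β := by
  have hM := hg.one_le
  have hE := hg.jumpMean_pos β
  rw [Real.coe_toNNReal _ (by positivity), abs_of_nonneg (by linarith)]
  have hX : 1 ≤ M * Real.exp β := one_le_mul_of_one_le_of_one_le hM (Real.one_le_exp (by linarith))
  have hmass : (tiltedJump g β).real univ ≤ M * Real.exp β :=
    (hg.measureReal_tiltedJump_univ_le (by linarith)).trans
      (by gcongr; exact div_le_self (Real.exp_pos _).le hβ)
  have hmean := (hg.jumpMean_le_measureReal_univ β).trans hmass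
  have hsd : jumpSD g β ≤ M * Real.exp β := le_of_sq_le_sq
    ((hg.jumpSD_sq_le_jumpMean β).trans (hmean.trans (le_self_pow₀ hX two_ne_zero))) (by positivity)
  rw [le_div_iff₀ hE]
  calc _ ≤ M * Real.exp β * (Real.exp (-(4 * β)) * (2 * π * ((M * Real.exp β + M * Real.exp β)
          * (M * Real.exp β + M * Real.exp β)))) * (M * Real.exp β) := by gcongr
    _ = 8 * π * M ^ 4 * (Real.exp β ^ 4 * Real.exp (-(4 * β))) := by ring
    _ = 8 * π * M ^ 4 := by
        rw [← Real.exp_nat_mul, ← Real.exp_add]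
        simp

lemma abs_stdDensity_sub_eq (hg : LevyDensityBounds g M ε) (β y : ℝ) :
    |stdDensity g β y - 1 / Real.sqrt (2 * π) * Real.exp (-y ^ 2 / 2)|
      = jumpSD g β * |compoundPoissonDensity (fun x => Real.exp (β * x) * g x)
          (jumpMean g β + jumpSD g β * y)
        - gaussianPDFReal (jumpMean g β) (jumpSD g β ^ 2) (jumpMean g β + jumpSD g β * y)| := by
  rw [← mul_gaussianPDFReal_affine (hg.jumpSD_pos β).ne' (jumpMean g β), stdDensity, ← mul_sub,
    abs_mul, NNReal.abs_eq]

theorem eventually_abs_stdDensity_sub_le (hg : LevyDensityBounds g M ε) :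
    ∀ᶠ β : ℝ in atTop, ∀ y,
      |stdDensity g β y - 1 / Real.sqrt (2 * π) * Real.exp (-y ^ 2 / 2)|
        ≤ Real.exp π * gaussMoment (2 / π ^ 2) 3 / jumpSD g β
          + gaussMoment (1 / 2) 2 / jumpSD g β ^ 2 + 8 * π * M ^ 4 / jumpMean g β := by
  filter_upwards [eventually_ge_atTop 1, hg.eventually_re_charFun_tiltedJump_le]
    with β hβ ⟨hmass, hdecay⟩ y
  have := hg.isFiniteMeasure_tiltedJump β
  have hσ : (0 : ℝ) < jumpSD g β := hg.jumpSD_pos β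
  rw [hg.abs_stdDensity_sub_eq]
  refine (mul_le_mul_of_nonneg_left
    (abs_compoundPoissonDensity_sub_gaussianPDFReal_le (μ := tiltedJump g β) rfl
      (hg.exp_mul_nonneg β) (hg.exp_mul_le β) (hg.ae_mem_Icc β) (hg.jumpSD_pos β).ne'
      (jumpSD_sq g β).symm hmass hdecay _) hσ.le).trans ?_
  rw [mul_add, mul_add]
  refine add_le_add (le_of_eq ?_) (hg.jumpSD_mul_exp_neg_mul_le hβ)
  field_simp

theorem eventually_abs_stdDensity_zero_sub_le (hg : LevyDensityBounds g M ε) :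
    ∀ᶠ β : ℝ in atTop, |stdDensity g β 0 - 1 / Real.sqrt (2 * π)|
      ≤ (Real.exp π ^ 2 * gaussMoment (2 / π ^ 2) 6 + Real.exp π * gaussMoment (2 / π ^ 2) 4
        + gaussMoment (1 / 2) 2) / jumpSD g β ^ 2 + 8 * π * M ^ 4 / jumpMean g β := by
  filter_upwards [eventually_ge_atTop 1, hg.eventually_re_charFun_tiltedJump_le]
    with β hβ ⟨hmass, hdecay⟩
  have := hg.isFiniteMeasure_tiltedJump β
  have hσ : (0 : ℝ) < jumpSD g β := hg.jumpSD_pos β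
  have heq := hg.abs_stdDensity_sub_eq β 0
  simp only [ne_eq, OfNat.ofNat_ne_zero, not_false_eq_true, zero_pow, neg_zero, zero_div,
    Real.exp_zero, mul_one, mul_zero, add_zero] at heq
  rw [heq]
  refine (mul_le_mul_of_nonneg_left
    (abs_compoundPoissonDensity_sub_gaussianPDFReal_le_at_mean (μ := tiltedJump g β) rfl
      (hg.exp_mul_nonneg β) (hg.exp_mul_le β) (hg.ae_mem_Icc β) (hg.jumpSD_pos β).ne'
      (jumpSD_sq g β).symm hmass hdecay) hσ.le).trans ?_
  rw [mul_add, mul_add]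
  refine add_le_add (le_of_eq ?_) (hg.jumpSD_mul_exp_neg_mul_le hβ)
  field_simp

theorem exists_abs_stdDensity_sub_le (hg : LevyDensityBounds g M ε) :
    ∃ K : ℝ, ∀ᶠ β : ℝ in atTop, ∀ y : ℝ,
      |stdDensity g β y - 1 / Real.sqrt (2 * π) * Real.exp (-y ^ 2 / 2)|
        ≤ K * (1 / Real.sqrt (jumpMean g β)) := by
  have hM := hg.one_le
  set c := ε / (4 * Real.exp 1 * M)
  have hc : 0 < c := div_pos hg.pos (by positivity)
  refine ⟨Real.exp π * gaussMoment (2 / π ^ 2) 3 / Real.sqrt c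
    + (gaussMoment (1 / 2) 2 / c + 8 * π * M ^ 4), ?_⟩
  filter_upwards [hg.eventually_abs_stdDensity_sub_le, hg.eventually_mul_jumpMean_le_jumpSD_sq,
    hg.tendsto_jumpMean.eventually_ge_atTop 1] with β h hvar hE y
  have hE0 := hg.jumpMean_pos β
  have hsqrt : 1 / jumpMean g β ≤ 1 / Real.sqrt (jumpMean g β) := by
    gcongr
    exact (Real.sqrt_le_left hE0.le).2 (le_self_pow₀ hE two_ne_zero)
  have hsd : Real.sqrt c * Real.sqrt (jumpMean g β) ≤ jumpSD g β := by
    rw [← Real.sqrt_mul hc.le]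
    exact (Real.sqrt_le_left (jumpSD g β).coe_nonneg).2 hvar
  have hmoment := gaussMoment_nonneg (1 / 2) 2
  rw [add_mul]
  refine (h y).trans ((add_assoc _ _ _).trans_le (add_le_add ?_ ?_))
  · exact div_le_div_mul_one_div (mul_nonneg (Real.exp_pos _).le (gaussMoment_nonneg _ _))
      (Real.sqrt_pos.2 hc) (Real.sqrt_pos.2 hE0) hsd
  · calc _ ≤ gaussMoment (1 / 2) 2 / c * (1 / jumpMean g β)
          + 8 * π * M ^ 4 * (1 / jumpMean g β) :=
          add_le_add (div_le_div_mul_one_div hmoment hc hE0 hvar) (mul_one_div _ _).ge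
      _ ≤ _ := by
          rw [← add_mul]
          gcongr

theorem exists_abs_stdDensity_zero_sub_le (hg : LevyDensityBounds g M ε) :
    ∃ K : ℝ, ∀ᶠ β : ℝ in atTop,
      |stdDensity g β 0 - 1 / Real.sqrt (2 * π)| ≤ K * (1 / jumpMean g β) := by
  have hM := hg.one_le
  refine ⟨(Real.exp π ^ 2 * gaussMoment (2 / π ^ 2) 6 + Real.exp π * gaussMoment (2 / π ^ 2) 4
    + gaussMoment (1 / 2) 2) / (ε / (4 * Real.exp 1 * M)) + 8 * π * M ^ 4, ?_⟩
  filter_upwards [hg.eventually_abs_stdDensity_zero_sub_le,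
    hg.eventually_mul_jumpMean_le_jumpSD_sq] with β h hvar
  have hmoment := gaussMoment_nonneg
  rw [add_mul]
  refine h.trans (add_le_add (div_le_div_mul_one_div ?_ (div_pos hg.pos (by positivity))
    (hg.jumpMean_pos β) hvar) (mul_one_div _ _).ge)
  exact add_nonneg (add_nonneg (mul_nonneg (by positivity) (hmoment _ _))
    (mul_nonneg (by positivity) (hmoment _ _))) (hmoment _ _)

end LevyDensityBounds

end Asymptotics

section PiecewiseRegularity

lemma exists_mem_Ioo_of_notMem_range {n : ℕ} {p : Fin (n + 1) → ℝ} {x : ℝ}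
    (hx : x ∈ Icc (p 0) (p (Fin.last n))) (hxp : x ∉ range p) :
    ∃ i : Fin n, x ∈ Ioo (p i.castSucc) (p i.succ) := by
  have hne : ∀ j, p j ≠ x := fun j h => hxp ⟨j, h⟩
  by_contra! hcon
  have hlt : ∀ j, p j < x := by
    intro j
    induction j using Fin.induction with
    | zero => exact hx.1.lt_of_ne (hne 0)
    | succ i ih => exact (not_lt.1 fun h => hcon i ⟨ih, h⟩).lt_of_ne (hne i.succ)
  exact (hlt _).not_ge hx.2

lemma isBounded_image_Ioo_of_tendsto {E : Type*} [NormedAddCommGroup E] {f : ℝ → E} {a b : ℝ}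
    {la lb : E} (hf : ContinuousOn f (Ioo a b)) (ha : Tendsto f (𝓝[>] a) (𝓝 la))
    (hb : Tendsto f (𝓝[<] b) (𝓝 lb)) : Bornology.IsBounded (f '' Ioo a b) := by
  refine ((isCompact_Icc.image_of_continuousOn
    (continuousOn_Icc_extendFrom_Ioo hf ha hb)).isBounded).subset ?_
  rw [← image_congr fun x hx => extendFrom_extends hf x hx]
  exact image_mono Ioo_subset_Icc_self

namespace PiecewiseC

variable {k : ℕ} {g : ℝ → ℝ} {a b : ℝ}

lemma of_le {l : ℕ} (h : PiecewiseC k g a b) (hl : l ≤ k) : PiecewiseC l g a b := by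
  obtain ⟨n, p, hp, ha, hb, hi⟩ := h
  exact ⟨n, p, hp, ha, hb, fun i =>
    ⟨(hi i).1.of_le (by exact_mod_cast hl), fun j hj => (hi i).2 j (hj.trans hl)⟩⟩

lemma exists_finite_continuousAt (h : PiecewiseC k g a b) :
    ∃ F : Set ℝ, F.Finite ∧ F ⊆ Icc a b ∧ ∀ x ∉ F, ContinuousAt ((Icc a b).indicator g) x := by
  obtain ⟨n, p, hp, rfl, rfl, hi⟩ := h
  refine ⟨range p, finite_range p, ?_, fun x hxp => ?_⟩
  · exact range_subset_iff.2 fun j => ⟨hp.monotone (Fin.zero_le j), hp.monotone (Fin.le_last j)⟩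
  by_cases hx : x ∈ Icc (p 0) (p (Fin.last n))
  · obtain ⟨i, hxi⟩ := exists_mem_Ioo_of_notMem_range hx hxp
    have hnhds := Ioo_mem_nhds hxi.1 hxi.2
    refine ((hi i).1.continuousOn.continuousAt hnhds).congr ?_
    filter_upwards [hnhds] with u hu
    have hu' : u ∈ Icc (p 0) (p (Fin.last n)) := ⟨(hp.monotone (Fin.zero_le _)).trans hu.1.le,
      hu.2.le.trans (hp.monotone (Fin.le_last _))⟩
    exact (indicator_of_mem hu' g).symm
  · refine (continuousAt_const (y := (0 : ℝ))).congr ?_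
    filter_upwards [isClosed_Icc.isOpen_compl.mem_nhds hx] with u hu
    exact (indicator_of_notMem hu g).symm

lemma exists_abs_le (h : PiecewiseC k g a b) : ∃ M, ∀ x ∈ Icc a b, |g x| ≤ M := by
  obtain ⟨n, p, -, rfl, rfl, hi⟩ := h
  have hpieces : ∀ i : Fin n, Bornology.IsBounded (g '' Ioo (p i.castSucc) (p i.succ)) := by
    intro i
    obtain ⟨⟨_, hleft⟩, ⟨_, hright⟩⟩ := (hi i).2 0 (Nat.zero_le k)
    rw [iteratedDeriv_zero] at hleft hright
    exact isBounded_image_Ioo_of_tendsto (hi i).1.continuousOn hleft hright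
  obtain ⟨M, hM⟩ := isBounded_iff_forall_norm_le.1
    (((finite_range p).image g).isBounded.union (Bornology.isBounded_iUnion.2 hpieces))
  refine ⟨M, fun x hx => hM _ ?_⟩
  by_cases hxp : x ∈ range p
  · exact Or.inl (mem_image_of_mem g hxp)
  · exact Or.inr (mem_iUnion.2 ((exists_mem_Ioo_of_notMem_range hx hxp).imp fun _ =>
      mem_image_of_mem g))

lemma exists_levyDensityBounds {ε : ℝ} (hg : PiecewiseC k g 0 1)
    (hg_nonneg : ∀ x ∈ Icc (0 : ℝ) 1, 0 ≤ g x) (hε : 0 < ε)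
    (hg_lower : ∀ x ∈ Icc (0 : ℝ) 1 ∩ Icc (1 - ε) 1, ε ≤ g x) :
    ∃ M, LevyDensityBounds ((Icc (0 : ℝ) 1).indicator g) M ε := by
  obtain ⟨F, hF, -, hcont⟩ := hg.exists_finite_continuousAt
  obtain ⟨M, hM⟩ := hg.exists_abs_le
  refine ⟨max M 1, ?_, indicator_nonneg hg_nonneg, ?_, fun x hx => indicator_of_notMem hx g,
    fun x hx hxε => ?_, le_max_right _ _, hε⟩
  · exact measurable_of_countable_not_continuousAt
      (hF.countable.mono fun x hx => by_contra fun h => hx (hcont x h))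
  · exact indicator_le' (g := fun _ => max M 1)
      (fun x hx => (le_abs_self _).trans ((hM x hx).trans (le_max_left _ _)))
      fun _ _ => zero_le_one.trans (le_max_right _ _)
  · rw [indicator_of_mem hx]
    exact hg_lower x ⟨hx, hxε, hx.2⟩

end PiecewiseC

end PiecewiseRegularity

section StandardizedTilt

lemma map_withDensity_comp {α γ : Type*} [MeasurableSpace α] [MeasurableSpace γ] {μ : Measure α}
    {φ : α → γ} (hφ : Measurable φ) {f : γ → ℝ≥0∞} (hf : Measurable f) :
    (μ.withDensity (f ∘ φ)).map φ = (μ.map φ).withDensity f := by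
  ext s hs
  rw [Measure.map_apply hφ hs, withDensity_apply _ (hφ hs), withDensity_apply _ hs,
    setLIntegral_map hs hf hφ]
  rfl

lemma map_volume_sub_div {σ : ℝ} (hσ : 0 < σ) (m : ℝ) :
    (volume : Measure ℝ).map (fun t => (t - m) / σ) = ENNReal.ofReal σ • volume := by
  have hcomp : (fun t : ℝ => (t - m) / σ) = (fun t => σ⁻¹ * t) ∘ fun t => t - m :=
    funext fun t => div_eq_inv_mul _ _
  rw [hcomp, ← Measure.map_map (by fun_prop) (by fun_prop), map_sub_right_eq_self,
    Real.map_volume_mul_left (inv_ne_zero hσ.ne'), inv_inv, abs_of_pos hσ]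

lemma map_withDensity_sub_div {h : ℝ → ℝ} (hh : Measurable h) {σ : ℝ} (hσ : 0 < σ) (m : ℝ) :
    (volume.withDensity fun t => ENNReal.ofReal (h t)).map (fun t => (t - m) / σ)
      = volume.withDensity fun y => ENNReal.ofReal (σ * h (m + σ * y)) := by
  have hcomp : (fun t => ENNReal.ofReal (h t))
      = (fun y => ENNReal.ofReal (h (m + σ * y))) ∘ fun t => (t - m) / σ := by
    funext t
    rw [Function.comp_apply, mul_div_cancel₀ _ hσ.ne', add_sub_cancel]
  rw [hcomp, map_withDensity_comp (by fun_prop) (by fun_prop), map_volume_sub_div hσ,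
    withDensity_smul_measure, ← withDensity_smul _ (by fun_prop)]
  refine congrArg _ (funext fun y => ?_)
  rw [ENNReal.ofReal_mul hσ.le]
  rfl

lemma isDefectiveDensity_map_sub_div {ν : Measure ℝ} {h : ℝ → ℝ} {c : ℝ≥0∞} (hc : 0 < c)
    (hh : Measurable h) (h0 : ∀ x, 0 ≤ h x)
    (hν : ν = c • Measure.dirac 0 + volume.withDensity fun x => ENNReal.ofReal (h x)) {σ : ℝ}
    (hσ : 0 < σ) (m : ℝ) :
    IsDefectiveDensity (ν.map fun t => (t - m) / σ) (-m / σ) fun y => σ * h (m + σ * y) := by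
  have hmap : ν.map (fun t => (t - m) / σ) = c • Measure.dirac (-m / σ)
      + volume.withDensity fun y => ENNReal.ofReal (σ * h (m + σ * y)) := by
    rw [hν, Measure.map_add _ _ (by fun_prop), Measure.map_smul, Measure.map_dirac' (by fun_prop),
      map_withDensity_sub_div hh hσ, zero_sub]
  have hatom : ν.map (fun t => (t - m) / σ) {-m / σ} = c := by
    rw [hmap]
    simp [(withDensity_absolutelyContinuous volume _) (Real.volume_singleton)]
  exact ⟨by fun_prop, fun y => mul_nonneg hσ.le (h0 _), hatom ▸ hc, hatom.symm ▸ hmap⟩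

namespace LevyDensityBounds

variable {g : ℝ → ℝ} {M ε : ℝ}

lemma continuousAt_stdDensity (hg : LevyDensityBounds g M ε) {β y : ℝ}
    (h : ContinuousAt g (jumpMean g β + jumpSD g β * y)) : ContinuousAt (stdDensity g β) y := by
  have := hg.isFiniteMeasure_tiltedJump β
  have hjump : ContinuousAt (fun x => Real.exp (β * x) * g x)
      (jumpMean g β + jumpSD g β * y) := ContinuousAt.mul (by fun_prop) h
  exact continuousAt_const.mul (ContinuousAt.comp (g := compoundPoissonDensity _)
    (f := fun y => jumpMean g β + jumpSD g β * y)
    (continuousAt_compoundPoissonDensity (μ := tiltedJump g β) hjump rfl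
      (hg.tiltedJump_le β)) (by fun_prop))

variable {ν : Measure ℝ}

lemma tiltMean_eq_jumpMean (hg : LevyDensityBounds g M ε)
    (h : ∀ θ, mgf id ν θ = Real.exp (mgf id (tiltedJump g 0) θ - (tiltedJump g 0).real univ))
    (β : ℝ) : tiltMean ν β = jumpMean g β := by
  rw [tiltMean_eq_integral_expTilt hg.integrableExpSet_tiltedJump_zero h,
    hg.expTilt_tiltedJump_zero, jumpMean]

lemma tiltSD_eq_jumpSD (hg : LevyDensityBounds g M ε)
    (h : ∀ θ, mgf id ν θ = Real.exp (mgf id (tiltedJump g 0) θ - (tiltedJump g 0).real univ))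
    (β : ℝ) : tiltSD ν β = jumpSD g β := by
  rw [tiltSD, variance_cramerTilt_eq_integral_expTilt hg.integrableExpSet_tiltedJump_zero h,
    hg.expTilt_tiltedJump_zero, coe_jumpSD]

theorem isDefectiveDensity_standardizedTilt (hg : LevyDensityBounds g M ε)
    (h : ∀ θ, mgf id ν θ = Real.exp (mgf id (tiltedJump g 0) θ - (tiltedJump g 0).real univ))
    (β : ℝ) :
    IsDefectiveDensity (standardizedTilt ν β) (-(tiltMean ν β) / tiltSD ν β)
      (stdDensity g β) := by
  have := hg.isFiniteMeasure_tiltedJump β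
  have : IsFiniteMeasure (cramerTilt ν β) := by
    rw [cramerTilt]
    infer_instance
  have hcharFun : ∀ t, charFun (cramerTilt ν β) t
      = Complex.exp (charFun (tiltedJump g β) t - (tiltedJump g β).real univ) := fun t => by
    rw [charFun_cramerTilt hg.integrableExpSet_tiltedJump_zero h, hg.expTilt_tiltedJump_zero]
  rw [standardizedTilt, hg.tiltMean_eq_jumpMean h, hg.tiltSD_eq_jumpSD h]
  exact isDefectiveDensity_map_sub_div (ENNReal.ofReal_pos.2 (Real.exp_pos _))
    (measurable_compoundPoissonDensity (μ := tiltedJump g β) (hg.measurable_exp_mul β) rfl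
      (hg.tiltedJump_le β))
    (compoundPoissonDensity_nonneg (μ := tiltedJump g β) (hg.exp_mul_nonneg β) rfl
      (hg.tiltedJump_le β))
    (compoundPoisson_eq_dirac_add_withDensity (μ := tiltedJump g β) (hg.measurable_exp_mul β)
      (hg.exp_mul_nonneg β) rfl (hg.tiltedJump_le β) hcharFun) (hg.jumpSD_pos β) _

end LevyDensityBounds

lemma HasLevyDensity.mgf_map {Ω : Type*} [MeasurableSpace Ω] {P : Measure Ω} {T : Ω → ℝ}
    {g : ℝ → ℝ} {M ε : ℝ} (hT : HasLevyDensity P T g)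
    (hg : LevyDensityBounds ((Icc (0 : ℝ) 1).indicator g) M ε) (θ : ℝ) :
    mgf id (P.map T) θ = Real.exp (mgf id (tiltedJump ((Icc (0 : ℝ) 1).indicator g) 0) θ
      - (tiltedJump ((Icc (0 : ℝ) 1).indicator g) 0).real univ) := by
  rw [mgf_id_map hT.1, hT.2, ← measureReal_expTilt_univ, hg.expTilt_tiltedJump_zero,
    hg.measureReal_tiltedJump_univ, hg.measureReal_tiltedJump_univ,
    ← integral_sub (hg.integrable_exp_mul θ) (hg.integrable_exp_mul 0),
    intervalIntegral.integral_of_le zero_le_one, ← integral_Icc_eq_integral_Ioc,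
    ← integral_indicator measurableSet_Icc]
  congr 2 with x
  simp only [zero_mul, Real.exp_zero, ← sub_mul]
  exact indicator_mul_right _ _ _

end StandardizedTilt

theorem mainTheorem1_general {Ω : Type*} [MeasurableSpace Ω] (P : Measure Ω)
    (T : Ω → ℝ) (g : ℝ → ℝ) (ε : ℝ)
    (hg_nonneg : ∀ x ∈ Icc (0 : ℝ) 1, 0 ≤ g x)
    (hg_piecewise : PiecewiseC 0 g 0 1)
    (hε : 0 < ε)
    (hg_lower : ∀ x ∈ Icc (0 : ℝ) 1 ∩ Icc (1 - ε) 1, ε ≤ g x)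
    (hT : HasLevyDensity P T g) :
    Tendsto (fun β : ℝ => tiltMean (P.map T) β) atTop atTop ∧
    ∃ f : ℝ → ℝ → ℝ,
      (∀ β : ℝ,
        IsDefectiveDensity (standardizedTilt (P.map T) β)
          (-(tiltMean (P.map T) β) / tiltSD (P.map T) β) (f β) ∧
        (∃ F : Set ℝ, F.Finite ∧ ∀ y, y ∉ F → ContinuousAt (f β) y) ∧
        (∀ y : ℝ, 1 < tiltMean (P.map T) β + tiltSD (P.map T) β * y →
          ContinuousAt (f β) y)) ∧
      (∃ K : ℝ, ∀ᶠ β : ℝ in atTop, ∀ y : ℝ,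
        |f β y - 1 / Real.sqrt (2 * Real.pi) * Real.exp (-y ^ 2 / 2)|
          ≤ K * (1 / Real.sqrt (tiltMean (P.map T) β))) ∧
      (∃ K : ℝ, ∀ᶠ β : ℝ in atTop,
        |f β 0 - 1 / Real.sqrt (2 * Real.pi)| ≤ K * (1 / tiltMean (P.map T) β)) := by
  obtain ⟨M, hg⟩ := hg_piecewise.exists_levyDensityBounds hg_nonneg hε hg_lower
  obtain ⟨F, hF, hF01, hcont⟩ := hg_piecewise.exists_finite_continuousAt
  have hmgf := hT.mgf_map hg
  have hdefective := hg.isDefectiveDensity_standardizedTilt hmgf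
  simp only [hg.tiltMean_eq_jumpMean hmgf, hg.tiltSD_eq_jumpSD hmgf] at hdefective ⊢
  refine ⟨hg.tendsto_jumpMean, stdDensity _, fun β => ⟨hdefective β, ?_, fun y hy => ?_⟩,
    hg.exists_abs_stdDensity_sub_le, hg.exists_abs_stdDensity_zero_sub_le⟩
  · have hinj : Function.Injective fun y : ℝ =>
        jumpMean ((Icc (0 : ℝ) 1).indicator g) β + jumpSD ((Icc (0 : ℝ) 1).indicator g) β * y :=
      (add_right_injective _).comp
        (mul_right_injective₀ (NNReal.coe_ne_zero.2 (hg.jumpSD_pos β).ne'))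
    exact ⟨_, hF.preimage hinj.injOn, fun y hy => hg.continuousAt_stdDensity (hcont _ hy)⟩
  · exact hg.continuousAt_stdDensity (hcont _ fun h => (hF01 h).2.not_gt hy)

/-- Local limit theorem for tilted sums. `f β` is the defective density of the standardized tilt
`Y_β`; it is taken continuous off a finite set and at all points `y` with `E_β + σ_β y > 1`, so
that it is determined up to its values at finitely many points, and `f β 0` is determined as soon
as `E_β > 1`. -/
theorem mainTheorem1 {Ω : Type*} [MeasurableSpace Ω] (P : Measure Ω) [IsProbabilityMeasure P]
    (T : Ω → ℝ) (g : ℝ → ℝ) (ε : ℝ)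
    (hg_nonneg : ∀ x ∈ Icc (0 : ℝ) 1, 0 ≤ g x)
    (hg_piecewise : PiecewiseC 2 g 0 1)
    (hε : 0 < ε)
    (hg_lower : ∀ x ∈ Icc (0 : ℝ) 1 ∩ Icc (1 - ε) 1, ε ≤ g x)
    (hT : HasLevyDensity P T g) :
    Tendsto (fun β : ℝ => tiltMean (P.map T) β) atTop atTop ∧
    ∃ f : ℝ → ℝ → ℝ,
      (∀ β : ℝ,
        IsDefectiveDensity (standardizedTilt (P.map T) β)
          (-(tiltMean (P.map T) β) / tiltSD (P.map T) β) (f β) ∧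
        (∃ F : Set ℝ, F.Finite ∧ ∀ y, y ∉ F → ContinuousAt (f β) y) ∧
        (∀ y : ℝ, 1 < tiltMean (P.map T) β + tiltSD (P.map T) β * y →
          ContinuousAt (f β) y)) ∧
      (∃ K : ℝ, ∀ᶠ β : ℝ in atTop, ∀ y : ℝ,
        |f β y - 1 / Real.sqrt (2 * Real.pi) * Real.exp (-y ^ 2 / 2)|
          ≤ K * (1 / Real.sqrt (tiltMean (P.map T) β))) ∧
      (∃ K : ℝ, ∀ᶠ β : ℝ in atTop,
        |f β 0 - 1 / Real.sqrt (2 * Real.pi)| ≤ K * (1 / tiltMean (P.map T) β)) := by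
  exact mainTheorem1_general P T g ε hg_nonneg (hg_piecewise.of_le zero_le_two) hε hg_lower hT
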